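/- Let $N\in\tfrac12\mathbb{Z}_{>0}$ and $\nu\in\tfrac12\mathbb{Z}_{\ge 0}$. Let $[N]$ be the representation space of the irreducible spin-$N$ representation of $\mathrm{su}(2)$, with hermitian generators $X_1,X_2,X_3$, $[X_a,X_b]=i\epsilon_{abc}X_c$ (repeated indices are summed), and let $\mathcal A_N=\mathrm{End}([N])$ be the algebra of complex $(2N+1)\times(2N+1)$-matrices. Put $Y_a=(N(N+1))^{-1/2}X_a$. Let $\mathrm{Der}_3$ be the span of the derivations $e_a=[X_a,\cdot\,]$ of $\mathcal A_N$; $r$-forms are the alternating $r$-linear maps $\mathrm{Der}_3^r\to\mathcal A_N$, $(\mathrm d\phi)(u)=u(\phi)$ for $\phi\in\mathcal A_N$, and $(\alpha\wedge\beta)(u,v)=\alpha(u)\beta(v)-\alpha(v)\beta(u)$ for one-forms. Let $$\omega=\frac{\epsilon_{abc}}{8\pi}\,Y_a\,\mathrm dY_b\wedge \mathrm dY_c .$$ The fuzzy integral $\int^{\star}\phi\,\omega:=\mathrm{Tr}(\phi)/(2N+1)$, $\phi\in\mathcal A_N$, is well defined on the two-forms $\phi\,\omega$. The representation $[N]\otimes[\nu]$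 has exactly one subrepresentation isomorphic to $[N+\nu]$ and, if $N>\nu$, exactly one isomorphic to $[N-\nu]$. Let $p\in\mathcal A_N\otimes\mathrm{End}([\nu])\cong M_{2\nu+1}(\mathcal A_N)$ be the orthogonal projection onto $[N+\nu]$ or (for $N>\nu$) onto $[N-\nu]$, and let $\mathbf F=\mathrm{Tr}\,p(\mathrm dp)(\mathrm dp)=\sum_{i,j,k}p_{ij}\,\mathrm dp_{jk}\wedge \mathrm dp_{ki}$. Then $$\mathbf F=\frac{iq}{4}\,\epsilon_{abc}Y_a\,\mathrm dY_b\wedge \mathrm dY_c,\qquad q=\frac4i\,\frac{(N(N+1))^{3/2}}{\frac12-N(N+1)}\,f,$$ where $$f=-iN\nu\,\frac{(N+\nu+1)(N+\nu+\frac12)}{(N+\nu)^2(2N+1)(N+1)}\ \text{ for } [N+\nu],\qquad f=\frac{i\nu(N+1)(N-\nu)(2N-2\nu+1)}{2N(2N+1)(N-\nu+1)^2}\ \text{ for } [N-\nu],$$ and the first Chern number of the fuzzy line bundle determined by $p$ is $$c_1(p):=\frac{i}{2\pi}\int^{\star}\mathbf F=-q .$$ If $\nu>0$, the number $c_1(p)$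 is never an integer. For fixed $\nu$, $$\lim_{N\to\infty}c_1(p)=\mp2\nu\in\mathbb Z,$$ with the minus sign for the projection onto $[N+\nu]$ and the plus sign for $[N-\nu]$. These limits are the Chern numbers of the line bundles $L^{\pm2\nu}$ over $S^2$: for $k\in\mathbb Z$ let $L^k$ be the line bundle associated with the Hopf fibration whose sections are the functions $\varphi$ on $S^3\subset\mathbb C^2$ with $\varphi(zu)=u^{-k}\varphi(z)$ for $u\in U(1)$. It is defined by the projector $p_k=|\psi\rangle\langle\psi|$ over $S^2$, where $\psi_j(z)=\binom{|k|}{j}^{1/2}z_1^{|k|-j}z_2^{j}$, $0\le j\le|k|$, with $z_1,z_2$ replaced by their complex conjugates if $k<0$; the Hopf map is $z\mapsto(2\,\mathrm{Re}\,\bar z_1z_2,\ 2\,\mathrm{Im}\,\bar z_1z_2,\ |z_1|^2-|z_2|^2)$. With the outward orientation of $S^2$, $\frac{i}{2\pi}\int_{S^2}\mathrm{Tr}\,p_k(\mathrm dp_k)(\mathrm dp_k)=-k$. -/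

import Mathlib

open scoped Kronecker

noncomputable section

namespace FuzzySphere

/-! ### Derivation-based differential forms over a complex algebra -/

section Calculus

variable {A : Type} [Ring A] [Algebra ℂ A]

/-- The inner derivation `f ↦ [x, f]`. -/
def innerDer (x : A) : Module.End ℂ A :=
  LinearMap.mulLeft ℂ x - LinearMap.mulRight ℂ x

/-- One-forms relative to a space `D` of vector fields: linear maps from `D` to `A`. -/
abbrev OneForm (D : Submodule ℂ (Module.End ℂ A)) : Type := D →ₗ[ℂ] A

/-- Two-forms relative to a space `D` of vector fields: alternating bilinear maps from `D` to `A`.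
Both kinds of forms are left `A`-modules by multiplication of the values from the left. -/
abbrev TwoForm (D : Submodule ℂ (Module.End ℂ A)) : Type := D [⋀^Fin 2]→ₗ[ℂ] A

/-- The exterior derivative of a zero-form: `(d f)(u) = u(f)`. -/
def dZero (D : Submodule ℂ (Module.End ℂ A)) (f : A) : OneForm D :=
  (LinearMap.applyₗ f).comp D.subtype

/-- The wedge product `(α ∧ β)(u, v) = α(u) β(v) - α(v) β(u)` of one-forms. -/
def wedge {D : Submodule ℂ (Module.End ℂ A)} (α β : OneForm D) : TwoForm D :=
  MultilinearMap.alternatization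
    ((MultilinearMap.mkPiAlgebraFin ℂ 2 A).compLinearMap ![α, β])

theorem wedge_apply {D : Submodule ℂ (Module.End ℂ A)} (α β : OneForm D) (u : Fin 2 → D) :
    wedge α β u = α (u 0) * β (u 1) - α (u 1) * β (u 0) := by
  have h : (Finset.univ : Finset (Equiv.Perm (Fin 2))) = {1, Equiv.swap 0 1} := by decide
  rw [wedge, MultilinearMap.alternatization_apply, h, Finset.sum_pair (by decide)]
  simp [List.ofFn_succ, sub_eq_add_neg]

/-- The first component `Tr p (dp) (dp)` of the Chern character of a matrix `p` over `A`. -/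
def chernForm (D : Submodule ℂ (Module.End ℂ A)) {ι : Type} [Fintype ι] (p : Matrix ι ι A) :
    TwoForm D :=
  ∑ i, ∑ j, ∑ k, p i j • wedge (dZero D (p j k)) (dZero D (p k i))

end Calculus

/-! ### The spin representations -/

/-- The algebra of the fuzzy sphere of spin `N = n / 2`: complex matrices of size `2 N + 1`. -/
abbrev Alg (n : ℕ) : Type := Matrix (Fin (n + 1)) (Fin (n + 1)) ℂ

/-- The raising operator of the spin `n / 2` representation, in the orthonormal basis of weight
vectors with weights `n / 2, n / 2 - 1, …, -n / 2`. -/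
def spinRaise (n : ℕ) : Alg n := fun i j =>
  if (i : ℕ) + 1 = j then (Real.sqrt ((j : ℝ) * ((n : ℝ) + 1 - j)) : ℂ) else 0

/-- The (hermitian) generators `X_1, X_2, X_3` of the irreducible spin `n / 2` representation
of `su(2)`, with `[X_a, X_b] = i ε_{abc} X_c`. -/
def spinX (n : ℕ) : Fin 3 → Alg n :=
  ![(1 / 2 : ℂ) • (spinRaise n + (spinRaise n).conjTranspose),
    (1 / (2 * Complex.I) : ℂ) • (spinRaise n - (spinRaise n).conjTranspose),
    Matrix.diagonal fun k => (n : ℂ) / 2 - (k : ℕ)]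

/-- The Hilbert space of the spin `n / 2` representation. -/
abbrev SpinSpace (n : ℕ) : Type := EuclideanSpace ℂ (Fin (n + 1))

/-- The tensor product of the spin `n / 2` and the spin `l / 2` representation space. -/
abbrev TensorSpace (n l : ℕ) : Type := EuclideanSpace ℂ (Fin (n + 1) × Fin (l + 1))

/-- The generators `X_a ⊗ 1 + 1 ⊗ X_a` of the tensor product representation. -/
def tensorX (n l : ℕ) (a : Fin 3) :
    Matrix (Fin (n + 1) × Fin (l + 1)) (Fin (n + 1) × Fin (l + 1)) ℂ :=
  spinX n a ⊗ₖ (1 : Alg l) + (1 : Alg n) ⊗ₖ spinX l a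

/-- `W` is a subrepresentation of `[n/2] ⊗ [l/2]` that is isomorphic to the irreducible spin
`m / 2` representation. -/
def IsSpinSubrep (n l m : ℕ) (W : Submodule ℂ (TensorSpace n l)) : Prop :=
  ∃ T : SpinSpace m →ₗ[ℂ] TensorSpace n l, Function.Injective T ∧ LinearMap.range T = W ∧
    ∀ (a : Fin 3) (v : SpinSpace m),
      T ((spinX m a).toEuclideanLin v) = (tensorX n l a).toEuclideanLin (T v)

/-- The span of all subrepresentations of `[n/2] ⊗ [l/2]` isomorphic to `[m/2]`; it is the
subrepresentation `[m/2]` itself when there is exactly one. -/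
def spinComponent (n l m : ℕ) : Submodule ℂ (TensorSpace n l) :=
  sSup {W | IsSpinSubrep n l m W}

/-- The orthogonal projection of `[n/2] ⊗ [l/2]` onto `[m/2]`, as a matrix with coefficients in
the algebra of the fuzzy sphere (an element of `End [n/2] ⊗ End [l/2]`). -/
def fuzzyProjector (n l m : ℕ) : Matrix (Fin (l + 1)) (Fin (l + 1)) (Alg n) := fun i j =>
  Matrix.of fun s t =>
    ((spinComponent n l m).starProjection (EuclideanSpace.single (t, j) (1 : ℂ))) (s, i)

/-! ### Forms, integral and Chern numbers on the fuzzy sphere -/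

/-- The space of vector fields spanned by the derivations `e_a = [X_a, ·]`. -/
def der3 (n : ℕ) : Submodule ℂ (Module.End ℂ (Alg n)) :=
  Submodule.span ℂ (Set.range fun a => innerDer (spinX n a))

/-- The totally antisymmetric symbol with value `1` at `(0, 1, 2)`. -/
def eps (a b c : Fin 3) : ℂ :=
  (((b : ℕ) : ℂ) - (a : ℕ)) * (((c : ℕ) : ℂ) - (a : ℕ)) * (((c : ℕ) : ℂ) - (b : ℕ)) / 2

/-- The normalized coordinates `Y_a = (N (N + 1))^{-1/2} X_a`, `N = n / 2`. -/
def coordY (n : ℕ) (a : Fin 3) : Alg n :=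
  ((1 / Real.sqrt ((n : ℝ) / 2 * ((n : ℝ) / 2 + 1)) : ℝ) : ℂ) • spinX n a

/-- The two-form `ε_{abc} Y_a dY_b ∧ dY_c`. -/
def epsYdYdY (n : ℕ) : TwoForm (der3 n) :=
  ∑ a, ∑ b, ∑ c, eps a b c •
    (coordY n a • wedge (dZero (der3 n) (coordY n b)) (dZero (der3 n) (coordY n c)))

/-- The noncommutative volume form. -/
def volForm (n : ℕ) : TwoForm (der3 n) := (1 / (8 * Real.pi) : ℂ) • epsYdYdY n

open Classical in
/-- The fuzzy integral: the two-form `φ ω` has the integral `Tr φ / (2 N + 1)`. (The value `0` is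
assigned to two-forms that are no multiples of the volume form `ω`.) -/
def fuzzyIntegral (n : ℕ) (η : TwoForm (der3 n)) : ℂ :=
  if h : ∃ φ : Alg n, η = φ • volForm n then h.choose.trace / ((n : ℂ) + 1) else 0

/-- The Chern form `F` of the fuzzy line bundle given by the projection onto `[m/2]`. -/
def fuzzyChernForm (n l m : ℕ) : TwoForm (der3 n) :=
  chernForm (der3 n) (fuzzyProjector n l m)

/-- The first Chern number of the fuzzy line bundle given by the projection onto `[m/2]`. -/
def fuzzyChern (n l m : ℕ) : ℂ :=
  Complex.I / (2 * Real.pi) * fuzzyIntegral n (fuzzyChernForm n l m)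

/-- The coefficient `f` for the projection onto `[N + ν]`. -/
def fPlus (N ν : ℝ) : ℂ :=
  -Complex.I * N * ν * ((N + ν + 1) * (N + ν + 1 / 2)) / ((N + ν) ^ 2 * (2 * N + 1) * (N + 1))

/-- The coefficient `f` for the projection onto `[N - ν]`. -/
def fMinus (N ν : ℝ) : ℂ :=
  Complex.I * ν * (N + 1) * (N - ν) * (2 * N - 2 * ν + 1) /
    (2 * N * (2 * N + 1) * (N - ν + 1) ^ 2)

/-- The charge `q` belonging to the coefficient `f`. -/
def charge (N : ℝ) (f : ℂ) : ℂ :=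
  4 / Complex.I * (((N * (N + 1)) ^ (3 / 2 : ℝ) / (1 / 2 - N * (N + 1)) : ℝ) : ℂ) * f

/-! ### Line bundles over the two-sphere -/

/-- The unit sphere in `ℂ²`. -/
def sphere3 : Set (ℂ × ℂ) := {z | ‖z.1‖ ^ 2 + ‖z.2‖ ^ 2 = 1}

/-- The Hopf map from the three-sphere to the two-sphere. -/
def hopf (z : ℂ × ℂ) : Fin 3 → ℝ :=
  ![2 * (star z.1 * z.2).re, 2 * (star z.1 * z.2).im, ‖z.1‖ ^ 2 - ‖z.2‖ ^ 2]

/-- The vector with the entries `√(|k| choose j) z₁^{|k| - j} z₂^j`, conjugated for `k < 0`. For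
`u` of modulus one it satisfies `ψ (u z) = u^k ψ z`. -/
def equivVec (k : ℤ) (z : ℂ × ℂ) : Fin (k.natAbs + 1) → ℂ := fun j =>
  (Real.sqrt (k.natAbs.choose j) : ℂ) *
    (if 0 ≤ k then z.1 ^ (k.natAbs - j) * z.2 ^ (j : ℕ)
      else star z.1 ^ (k.natAbs - j) * star z.2 ^ (j : ℕ))

/-- The rank-one projector `|ψ⟩⟨ψ|` at a point of the three-sphere. -/
def hopfProjector (k : ℤ) (z : ℂ × ℂ) :
    Matrix (Fin (k.natAbs + 1)) (Fin (k.natAbs + 1)) ℂ :=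
  Matrix.vecMulVec (equivVec k z) (star (equivVec k z))

open Classical in
/-- The projector over the two-sphere that defines the line bundle `L^k` associated with the Hopf
fibration (sections: functions on the three-sphere with `φ (z u) = u^{-k} φ z`): its value at a
point is `|ψ⟩⟨ψ|` at any lift of that point to the three-sphere. -/
def lineBundleProjector (k : ℤ) (x : Fin 3 → ℝ) :
    Matrix (Fin (k.natAbs + 1)) (Fin (k.natAbs + 1)) ℂ :=
  if h : ∃ z ∈ sphere3, hopf z = x then hopfProjector k h.choose else 0

theorem equivVec_smul (k : ℤ) (u : ℂ) (z : ℂ × ℂ) (j : Fin (k.natAbs + 1)) :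
    equivVec k (u * z.1, u * z.2) j =
      (if 0 ≤ k then u else star u) ^ k.natAbs * equivVec k z j := by
  have hj : k.natAbs = (k.natAbs - j) + (j : ℕ) := by have := j.2; omega
  unfold equivVec
  split_ifs
  · conv_rhs => rw [show u ^ k.natAbs = u ^ (k.natAbs - j) * u ^ (j : ℕ) by rw [← pow_add, ← hj]]
    ring
  · conv_rhs => rw [show star u ^ k.natAbs = star u ^ (k.natAbs - j) * star u ^ (j : ℕ) by
      rw [← pow_add, ← hj]]
    simp only [star_mul']
    ring

theorem hopf_fiber {z w : ℂ × ℂ} (hz : z ∈ sphere3) (hw : w ∈ sphere3) (h : hopf w = hopf z) :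
    ∃ u : ℂ, u * star u = 1 ∧ w = (u * z.1, u * z.2) := by
  obtain ⟨z₁, z₂⟩ := z
  obtain ⟨w₁, w₂⟩ := w
  have h0 := congrFun h 0
  have h1 := congrFun h 1
  have h2 := congrFun h 2
  simp only [sphere3, Set.mem_ofPred_eq] at hz hw
  simp [hopf] at h0 h1 h2
  have e1 : ‖w₁‖ ^ 2 = ‖z₁‖ ^ 2 := by linarith
  have e2 : ‖w₂‖ ^ 2 = ‖z₂‖ ^ 2 := by linarith
  have c (x : ℂ) : x * star x = ((‖x‖ ^ 2 : ℝ) : ℂ) := by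
    have := Complex.mul_conj' x
    push_cast; exact this
  have f1 : w₁ * star w₁ = z₁ * star z₁ := by rw [c, c, e1]
  have f2 : w₂ * star w₂ = z₂ * star z₂ := by rw [c, c, e2]
  have f3 : star w₁ * w₂ = star z₁ * z₂ := by
    apply Complex.ext
    · simp; linarith
    · simp; linarith
  have f4 : w₁ * star w₂ = z₁ * star z₂ := by
    have := congrArg star f3
    simpa [mul_comm] using this
  have gz : z₁ * star z₁ + z₂ * star z₂ = 1 := by
    rw [c, c, ← Complex.ofReal_add, hz, Complex.ofReal_one]
  have gw : w₁ * star w₁ + w₂ * star w₂ = 1 := by rw [f1, f2, gz]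
  refine ⟨w₁ * star z₁ + w₂ * star z₂, ?_, ?_⟩
  · simp only [star_add, star_mul', star_star]
    linear_combination (z₁ * star z₁) * f1 + (z₂ * star z₂) * f2 +
      (star z₁ * z₂) * f4 + (z₁ * star z₂) * f3 + (z₁ * star z₁ + z₂ * star z₂ + 1) * gz
  · ext
    · show w₁ = (w₁ * star z₁ + w₂ * star z₂) * z₁
      linear_combination (-w₁) * gw + w₁ * f1 + w₂ * f4
    · show w₂ = (w₁ * star z₁ + w₂ * star z₂) * z₂
      linear_combination (-w₂) * gw + w₁ * f3 + w₂ * f2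

/-- The value of the projector does not depend on the chosen lift. -/
theorem lineBundleProjector_hopf (k : ℤ) {z : ℂ × ℂ} (hz : z ∈ sphere3) :
    lineBundleProjector k (hopf z) = hopfProjector k z := by
  have h : ∃ w ∈ sphere3, hopf w = hopf z := ⟨z, hz, rfl⟩
  rw [lineBundleProjector, dif_pos h]
  obtain ⟨u, hu, hw⟩ := hopf_fiber hz h.choose_spec.1 h.choose_spec.2
  rw [hw]
  have hu' : (if 0 ≤ k then u else star u) * star (if 0 ≤ k then u else star u) = 1 := by
    split_ifs
    · exact hu
    · rw [star_star, mul_comm]; exact hu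
  ext i j
  simp only [hopfProjector, Matrix.vecMulVec_apply, Pi.star_apply, equivVec_smul, star_mul',
    star_pow]
  generalize (if 0 ≤ k then u else star u) = v at hu'
  calc _ = (v * star v) ^ k.natAbs * (equivVec k z i * star (equivVec k z j)) := by
        rw [mul_pow]; ring
    _ = _ := by rw [hu', one_pow, one_mul]

/-- Spherical coordinates on the two-sphere. -/
def sphereParam (θ φ : ℝ) : Fin 3 → ℝ :=
  ![Real.sin θ * Real.cos φ, Real.sin θ * Real.sin φ, Real.cos θ]

/-- The first Chern number `(i / 2π) ∫_{S²} Tr P (dP) (dP)` of a matrix-valued function on the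
two-sphere, which carries the orientation of the outward normal. -/
def sphereChern {ι : Type} [Fintype ι] (P : (Fin 3 → ℝ) → Matrix ι ι ℂ) : ℂ :=
  Complex.I / (2 * Real.pi) *
    ∫ θ in (0 : ℝ)..Real.pi, ∫ φ in (0 : ℝ)..(2 * Real.pi),
      ∑ i, ∑ j, ∑ k, P (sphereParam θ φ) i j *
        (deriv (fun t => P (sphereParam t φ) j k) θ * deriv (fun t => P (sphereParam θ t) k i) φ -
          deriv (fun t => P (sphereParam θ t) j k) φ * deriv (fun t => P (sphereParam t φ) k i) θ)

end FuzzySphere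

end

/-! Write `L_a = X_a ⊗ 1`, `R_a = 1 ⊗ X_a` and `J = L + R`, and let `P = τ τ*` for an isometric
intertwiner `τ` from `[m/2]`. Such a `τ` is unique up to a scalar, because a highest weight vector
of the given weight is fixed by one coordinate (`exists_isometric_intertwining`).

Since `J` commutes with `P`, the derivation `[L_a, ·]` acts on `P` as `-[R_a, ·]`. Hence `P [L_a, P]
[L_b, P] = P R_a P R_b P - P R_a R_b P`. By the Wigner–Eckart theorem for vector operators
(`IsVectorOperator.exists_eq_smul`), `τ* R_a τ = κ X_a`. Antisymmetrizing in `a, b` therefore gives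
`(κ² - κ) i ε_{abc} J_c P`. The same theorem shows that the trace of `J_c P` over the second factor
is `ρ X_c`, so `F(e_a, e_b) = (κ² - κ) ρ i ε_{abc} X_c` (`chernForm_projector_apply`). The Casimir
operators determine `κ` and `ρ`. The form `ε Y dY dY` is also a multiple of `ε_{abc} X_c` on `(e_a,
e_b)` (`epsYdYdY_apply`), and two-forms are determined by these values. Comparing the two gives `q`.

The Chern number is a nonzero rational multiple of `√(N(N+1)) = √(n(n+2)) / 2`, which is irrational
because `n(n+2)` lies strictly between consecutive squares. The limits follow from continuity at `t
= 1/N = 0`.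

Over `S²`, a lift can be chosen whose components have moduli depending only on `θ` and phases `e^{±
i j φ}`. The curvature is then, up to the factor `± i`, the `θ`-derivative of the mean of a binomial
distribution with parameter `sin²(θ/2)` (`curvature_lineBundleProjector`). -/

open scoped Kronecker

noncomputable section

namespace FuzzySphere

/-! ### Vector operators and their ladder components. -/

section VectorOperators

variable {A : Type} [Ring A] [Algebra ℂ A]

/-- `v` is a vector operator for `x`: `[x_a, v_b] = i ε_{abc} v_c`. For `v = x` these are the
commutation relations of `su(2)`. -/
def IsVectorOperator (x v : Fin 3 → A) : Prop :=
  ∀ a b, x a * v b - v b * x a = ∑ c, (Complex.I * eps a b c) • v c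

theorem isVectorOperator_self_of {x : Fin 3 → A}
    (h01 : x 0 * x 1 - x 1 * x 0 = Complex.I • x 2)
    (h12 : x 1 * x 2 - x 2 * x 1 = Complex.I • x 0)
    (h20 : x 2 * x 0 - x 0 * x 2 = Complex.I • x 1) : IsVectorOperator x x := by
  intro a b
  fin_cases a <;> fin_cases b <;> simp [Fin.sum_univ_three, eps] <;> norm_num
  · exact h01
  · rw [← h20]; abel
  · rw [← h01]; abel
  · exact h12
  · exact h20
  · rw [← h12]; abel

theorem IsVectorOperator.apply₀₁ {x v : Fin 3 → A} (h : IsVectorOperator x v) :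
    x 0 * v 1 - v 1 * x 0 = Complex.I • v 2 := by
  rw [h]; simp [Fin.sum_univ_three, eps]; norm_num

theorem IsVectorOperator.apply₁₀ {x v : Fin 3 → A} (h : IsVectorOperator x v) :
    x 1 * v 0 - v 0 * x 1 = -Complex.I • v 2 := by
  rw [h]; simp [Fin.sum_univ_three, eps]; norm_num

theorem IsVectorOperator.apply₁₂ {x v : Fin 3 → A} (h : IsVectorOperator x v) :
    x 1 * v 2 - v 2 * x 1 = Complex.I • v 0 := by
  rw [h]; simp [Fin.sum_univ_three, eps]; norm_num

theorem IsVectorOperator.apply₂₁ {x v : Fin 3 → A} (h : IsVectorOperator x v) :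
    x 2 * v 1 - v 1 * x 2 = -Complex.I • v 0 := by
  rw [h]; simp [Fin.sum_univ_three, eps]; norm_num

theorem IsVectorOperator.apply₂₀ {x v : Fin 3 → A} (h : IsVectorOperator x v) :
    x 2 * v 0 - v 0 * x 2 = Complex.I • v 1 := by
  rw [h]; simp [Fin.sum_univ_three, eps]; norm_num

theorem IsVectorOperator.apply₀₂ {x v : Fin 3 → A} (h : IsVectorOperator x v) :
    x 0 * v 2 - v 2 * x 0 = -Complex.I • v 1 := by
  rw [h]; simp [Fin.sum_univ_three, eps]; norm_num

theorem IsVectorOperator.apply_self {x v : Fin 3 → A} (h : IsVectorOperator x v) (a : Fin 3) :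
    x a * v a - v a * x a = 0 := by
  rw [h]; fin_cases a <;> simp [eps]

theorem IsVectorOperator.sub {x v w : Fin 3 → A} (hv : IsVectorOperator x v)
    (hw : IsVectorOperator x w) : IsVectorOperator x (v - w) := by
  intro a b
  simp only [Pi.sub_apply, smul_sub, Finset.sum_sub_distrib, ← hv a b, ← hw a b]
  noncomm_ring

theorem IsVectorOperator.smul {x v : Fin 3 → A} (hv : IsVectorOperator x v) (κ : ℂ) :
    IsVectorOperator x (κ • v) := by
  intro a b
  simp only [Pi.smul_apply, mul_smul_comm, smul_mul_assoc, ← smul_sub, hv a b, Finset.smul_sum]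
  exact Finset.sum_congr rfl fun c _ => smul_comm _ _ _

/-- A vector operator whose raising component vanishes is zero. -/
theorem IsVectorOperator.eq_zero {x v : Fin 3 → A} (h : IsVectorOperator x v)
    (h0 : v 0 + Complex.I • v 1 = 0) : v = 0 := by
  have hI : Complex.I ≠ 0 := Complex.I_ne_zero
  have e : v 0 = -(Complex.I • v 1) := eq_neg_of_add_eq_zero_left h0
  -- Since `v₀ = -i v₁`, the relation `[x₀, v₀] = 0` forces `[x₀, v₁] = i v₂` to vanish. The other
  -- components are, up to a factor, commutators with `v₂`.
  have h2 : v 2 = 0 := by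
    have h1 := h.apply₀₁
    have h3 := h.apply_self 0
    rw [e] at h3
    have : Complex.I • (x 0 * v 1 - v 1 * x 0) = 0 := by
      rw [← neg_eq_zero, ← h3]
      simp only [mul_neg, neg_mul, mul_smul_comm, smul_mul_assoc, smul_sub]
      abel
    rw [h1, smul_eq_zero, smul_eq_zero] at this
    tauto
  have h3 := h.apply₁₂
  have h4 := h.apply₀₂
  rw [h2] at h3 h4
  simp [hI] at h3 h4
  funext a
  fin_cases a
  · exact (smul_eq_zero.1 h3.symm).resolve_left hI
  · simpa using h4
  · simpa using h2

theorem IsVectorOperator.lie_two_raise {x v : Fin 3 → A} (h : IsVectorOperator x v) :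
    x 2 * (v 0 + Complex.I • v 1) - (v 0 + Complex.I • v 1) * x 2 = v 0 + Complex.I • v 1 := by
  have e1 := h.apply₂₀
  have e2 := h.apply₂₁
  have : x 2 * (v 0 + Complex.I • v 1) - (v 0 + Complex.I • v 1) * x 2 =
      (x 2 * v 0 - v 0 * x 2) + Complex.I • (x 2 * v 1 - v 1 * x 2) := by
    simp only [mul_add, add_mul, mul_smul_comm, smul_mul_assoc, smul_sub]; abel
  rw [this, e1, e2, smul_smul, mul_neg, Complex.I_mul_I, neg_neg, one_smul, add_comm]

theorem IsVectorOperator.lie_two_lower {x v : Fin 3 → A} (h : IsVectorOperator x v) :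
    x 2 * (v 0 - Complex.I • v 1) - (v 0 - Complex.I • v 1) * x 2 = -(v 0 - Complex.I • v 1) := by
  have e1 := h.apply₂₀
  have e2 := h.apply₂₁
  have : x 2 * (v 0 - Complex.I • v 1) - (v 0 - Complex.I • v 1) * x 2 =
      (x 2 * v 0 - v 0 * x 2) - Complex.I • (x 2 * v 1 - v 1 * x 2) := by
    simp only [mul_sub, sub_mul, mul_smul_comm, smul_mul_assoc, smul_sub]; abel
  rw [this, e1, e2, smul_smul, mul_neg, Complex.I_mul_I, neg_neg, one_smul, neg_sub]

/-- Applied to matrices, this relation links neighbouring matrix elements of the raising component,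
which is the recursion in `IsVectorOperator.exists_eq_smul`. -/
theorem IsVectorOperator.lie_raise_raise {x v : Fin 3 → A} (h : IsVectorOperator x v) :
    (x 0 + Complex.I • x 1) * (v 0 + Complex.I • v 1) =
      (v 0 + Complex.I • v 1) * (x 0 + Complex.I • x 1) := by
  have : (x 0 + Complex.I • x 1) * (v 0 + Complex.I • v 1) -
      (v 0 + Complex.I • v 1) * (x 0 + Complex.I • x 1) =
      (x 0 * v 0 - v 0 * x 0) + Complex.I • (x 0 * v 1 - v 1 * x 0) +
      Complex.I • (x 1 * v 0 - v 0 * x 1) +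
        (Complex.I * Complex.I) • (x 1 * v 1 - v 1 * x 1) := by
    simp only [mul_add, add_mul, mul_smul_comm, smul_mul_assoc, smul_sub, smul_smul, smul_add]
    abel
  rw [← sub_eq_zero, this, h.apply_self, h.apply_self, h.apply₀₁, h.apply₁₀]
  simp

theorem IsVectorOperator.lie_raise_lower {x v : Fin 3 → A} (h : IsVectorOperator x v) :
    (x 0 + Complex.I • x 1) * (v 0 - Complex.I • v 1) -
      (v 0 - Complex.I • v 1) * (x 0 + Complex.I • x 1) = (2 : ℂ) • v 2 := by
  have : (x 0 + Complex.I • x 1) * (v 0 - Complex.I • v 1) -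
      (v 0 - Complex.I • v 1) * (x 0 + Complex.I • x 1) =
      (x 0 * v 0 - v 0 * x 0) - Complex.I • (x 0 * v 1 - v 1 * x 0) +
      Complex.I • (x 1 * v 0 - v 0 * x 1) -
        (Complex.I * Complex.I) • (x 1 * v 1 - v 1 * x 1) := by
    simp only [mul_add, add_mul, mul_sub, sub_mul, mul_smul_comm, smul_mul_assoc, smul_sub,
      smul_smul, smul_add]
    abel
  rw [this, h.apply_self, h.apply_self, h.apply₀₁, h.apply₁₀]
  simp [smul_smul, two_smul]

end VectorOperators

/-! ### The spin matrices -/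

theorem spinX_zero_add (n : ℕ) : spinX n 0 + Complex.I • spinX n 1 = spinRaise n := by
  have : Complex.I * (1 / (2 * Complex.I)) = 1 / 2 := by field_simp
  simp only [spinX, Matrix.cons_val_zero, Matrix.cons_val_one, smul_smul, this, ← smul_add]
  rw [show spinRaise n + (spinRaise n).conjTranspose + (spinRaise n - (spinRaise n).conjTranspose)
    = (2 : ℂ) • spinRaise n by rw [two_smul]; abel, smul_smul]
  norm_num

theorem spinX_zero_sub (n : ℕ) :
    spinX n 0 - Complex.I • spinX n 1 = (spinRaise n).conjTranspose := by
  have : Complex.I * (1 / (2 * Complex.I)) = 1 / 2 := by field_simp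
  simp only [spinX, Matrix.cons_val_zero, Matrix.cons_val_one, smul_smul, this, ← smul_sub]
  rw [show spinRaise n + (spinRaise n).conjTranspose - (spinRaise n - (spinRaise n).conjTranspose)
    = (2 : ℂ) • (spinRaise n).conjTranspose by rw [two_smul]; abel, smul_smul]
  norm_num

theorem spinX_zero (n : ℕ) :
    spinX n 0 = (1 / 2 : ℂ) • (spinRaise n + (spinRaise n).conjTranspose) := rfl

theorem spinX_one (n : ℕ) :
    spinX n 1 = (1 / (2 * Complex.I) : ℂ) • (spinRaise n - (spinRaise n).conjTranspose) := rfl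

theorem spinX_two (n : ℕ) :
    spinX n 2 = Matrix.diagonal fun k : Fin (n + 1) => (n : ℂ) / 2 - ((k : ℕ) : ℂ) := rfl

theorem spinX_isHermitian (n : ℕ) (a : Fin 3) : (spinX n a).conjTranspose = spinX n a := by
  fin_cases a
  · simp [spinX, add_comm]
  · simp only [spinX, Fin.mk_one, Matrix.cons_val_one, Matrix.cons_val_zero]
    rw [Matrix.conjTranspose_smul, Matrix.conjTranspose_sub, Matrix.conjTranspose_conjTranspose,
      ← neg_sub, smul_neg, ← neg_smul]
    congr 1
    simp
  · simp only [spinX, Fin.reduceFinMk, Matrix.cons_val, Matrix.diagonal_conjTranspose]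
    congr 1
    funext k
    simp

/-- The matrix element of the raising operator between neighbouring weight vectors. -/
def ladder (n k : ℕ) : ℝ := Real.sqrt (((k : ℝ) + 1) * ((n : ℝ) - k))

theorem ladder_mul_self {n k : ℕ} (h : k ≤ n) :
    ladder n k * ladder n k = ((k : ℝ) + 1) * ((n : ℝ) - k) := by
  have : (k : ℝ) ≤ n := by exact_mod_cast h
  exact Real.mul_self_sqrt (by apply mul_nonneg <;> [positivity; linarith])

theorem ladder_ne_zero {n k : ℕ} (h : k < n) : ladder n k ≠ 0 := by
  have : (k : ℝ) < n := by exact_mod_cast h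
  exact (Real.sqrt_pos.2 (by apply mul_pos <;> [positivity; linarith])).ne'

theorem spinRaise_apply (n : ℕ) (i j : Fin (n + 1)) :
    spinRaise n i j = if (i : ℕ) + 1 = j then (ladder n i : ℂ) else 0 := by
  unfold spinRaise ladder
  split_ifs with h
  · rw [← h]; push_cast; congr 3; ring
  · rfl

theorem sum_spinRaise_mul (n : ℕ) (i : Fin (n + 1)) (f : Fin (n + 1) → ℂ) :
    ∑ j, spinRaise n i j * f j =
      if h : (i : ℕ) + 1 < n + 1 then (ladder n i : ℂ) * f ⟨i + 1, h⟩ else 0 := by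
  simp only [spinRaise_apply, ite_mul, zero_mul]
  split_ifs with h
  · rw [Finset.sum_eq_single ⟨i + 1, h⟩]
    · simp
    · intro b _ hb
      rw [if_neg]
      intro hc; exact hb (Fin.ext hc.symm)
    · simp
  · apply Finset.sum_eq_zero
    intro j _
    rw [if_neg]
    have := j.2; omega

theorem sum_mul_spinRaise (n : ℕ) (k : ℕ) (h : k + 1 < n + 1) (f : Fin (n + 1) → ℂ) :
    ∑ i, f i * spinRaise n i ⟨k + 1, h⟩ = f ⟨k, by omega⟩ * ladder n k := by
  simp only [spinRaise_apply, mul_ite, mul_zero]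
  rw [Finset.sum_eq_single ⟨k, by omega⟩]
  · simp
  · intro b _ hb
    rw [if_neg]
    intro hc; exact hb (Fin.ext (by simpa using hc))
  · simp

theorem sum_mul_spinRaise_zero (n : ℕ) (f : Fin (n + 1) → ℂ) :
    ∑ i, f i * spinRaise n i 0 = 0 := by
  simp [spinRaise_apply]

theorem star_spinRaise_apply (n : ℕ) (i j : Fin (n + 1)) :
    star (spinRaise n i j) = spinRaise n i j := by
  rw [spinRaise_apply]; split_ifs <;> simp

theorem spinRaise_mul_conjTranspose (n : ℕ) :
    spinRaise n * (spinRaise n).conjTranspose =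
      Matrix.diagonal fun k : Fin (n + 1) => (((k : ℕ) : ℂ) + 1) * ((n : ℂ) - (k : ℕ)) := by
  ext i j
  simp only [Matrix.mul_apply, Matrix.conjTranspose_apply, star_spinRaise_apply]
  rw [sum_spinRaise_mul, Matrix.diagonal_apply]
  split_ifs with h h2 h2
  · subst h2
    rw [spinRaise_apply, if_pos rfl, ← Complex.ofReal_mul, ladder_mul_self (by omega)]
    push_cast; ring
  · rw [spinRaise_apply, if_neg, mul_zero]
    intro hc; apply h2; apply Fin.ext; simp at hc; omega
  -- The last row has no entry to its right; the diagonal value agrees because its factor `n - k` is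
  -- zero.
  · have : (i : ℕ) = n := by have := i.2; omega
    rw [this]; ring
  · rfl

theorem conjTranspose_mul_spinRaise (n : ℕ) :
    (spinRaise n).conjTranspose * spinRaise n =
      Matrix.diagonal fun k : Fin (n + 1) => ((k : ℕ) : ℂ) * ((n : ℂ) + 1 - (k : ℕ)) := by
  ext i j
  simp only [Matrix.mul_apply, Matrix.conjTranspose_apply, star_spinRaise_apply]
  rw [Matrix.diagonal_apply]
  obtain ⟨j, hj⟩ := j
  obtain _ | j := j
  · have := sum_mul_spinRaise_zero n fun k => spinRaise n k i
    rw [show (⟨0, hj⟩ : Fin (n + 1)) = 0 from rfl, this]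
    split_ifs with h
    · subst h; simp
    · rfl
  · rw [sum_mul_spinRaise n j hj fun k => spinRaise n k i, spinRaise_apply]
    by_cases h : i = ⟨j + 1, hj⟩
    · subst h
      rw [if_pos rfl, if_pos rfl, ← Complex.ofReal_mul, ladder_mul_self (by omega)]
      push_cast; ring
    · rw [if_neg, if_neg h, zero_mul]
      intro hc; exact h (Fin.ext hc.symm)

theorem lie_spinX_two_spinRaise (n : ℕ) :
    spinX n 2 * spinRaise n - spinRaise n * spinX n 2 = spinRaise n := by
  ext i j
  rw [spinX_two, Matrix.sub_apply, Matrix.diagonal_mul, Matrix.mul_diagonal, spinRaise_apply]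
  split_ifs with h
  · rw [← h]; push_cast; ring
  · simp

theorem lie_spinX_two_conjTranspose (n : ℕ) :
    spinX n 2 * (spinRaise n).conjTranspose - (spinRaise n).conjTranspose * spinX n 2 =
      -(spinRaise n).conjTranspose := by
  conv_rhs => rw [← lie_spinX_two_spinRaise n]
  rw [Matrix.conjTranspose_sub, Matrix.conjTranspose_mul, Matrix.conjTranspose_mul,
    spinX_isHermitian]
  abel

theorem lie_spinRaise_conjTranspose (n : ℕ) :
    spinRaise n * (spinRaise n).conjTranspose - (spinRaise n).conjTranspose * spinRaise n =
      (2 : ℂ) • spinX n 2 := by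
  rw [spinRaise_mul_conjTranspose, conjTranspose_mul_spinRaise, Matrix.diagonal_sub, spinX_two,
    ← Matrix.diagonal_smul]
  congr 1
  funext k
  simp only [Pi.smul_apply, smul_eq_mul]
  ring

theorem isVectorOperator_spinX (n : ℕ) : IsVectorOperator (spinX n) (spinX n) := by
  have h1 := lie_spinX_two_spinRaise n
  have h2 := lie_spinX_two_conjTranspose n
  have h3 := lie_spinRaise_conjTranspose n
  have hI : (1 / (2 * Complex.I) : ℂ) = -(Complex.I / 2) := by
    field_simp; simp
  refine isVectorOperator_self_of ?_ ?_ ?_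
  · rw [spinX_zero, spinX_one, hI]
    generalize spinRaise n = R at *
    generalize R.conjTranspose = S at *
    have : ((1 / 2 : ℂ) • (R + S)) * ((-(Complex.I / 2)) • (R - S)) -
      ((-(Complex.I / 2)) • (R - S)) * ((1 / 2 : ℂ) • (R + S)) =
      (Complex.I / 2) • (R * S - S * R) := by
      simp only [smul_mul_smul_comm, add_mul, mul_add, sub_mul, mul_sub]
      module
    rw [this, h3, smul_smul]
    congr 1; ring
  · rw [spinX_zero, spinX_one, hI]
    generalize spinRaise n = R at *
    generalize R.conjTranspose = S at *
    have : ((-(Complex.I / 2)) • (R - S)) * spinX n 2 - spinX n 2 * ((-(Complex.I / 2)) • (R - S)) =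
      (Complex.I / 2) • ((spinX n 2 * R - R * spinX n 2) - (spinX n 2 * S - S * spinX n 2)) := by
      simp only [smul_mul_assoc, mul_smul_comm, sub_mul, mul_sub]
      module
    rw [this, h1, h2]
    module
  · rw [spinX_zero, spinX_one, hI]
    generalize spinRaise n = R at *
    generalize R.conjTranspose = S at *
    have : spinX n 2 * ((1 / 2 : ℂ) • (R + S)) - ((1 / 2 : ℂ) • (R + S)) * spinX n 2 =
      (1 / 2 : ℂ) • ((spinX n 2 * R - R * spinX n 2) + (spinX n 2 * S - S * spinX n 2)) := by
      simp only [smul_mul_assoc, mul_smul_comm, add_mul, mul_add]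
      module
    rw [this, h1, h2, smul_smul, mul_neg, ← mul_div_assoc, Complex.I_mul_I]
    module

/-- The Casimir operator of the spin `n / 2` representation. -/
theorem sum_spinX_mul_self (n : ℕ) :
    ∑ a, spinX n a * spinX n a = ((n : ℂ) / 2 * ((n : ℂ) / 2 + 1)) • (1 : Alg n) := by
  have h3 := spinRaise_mul_conjTranspose n
  have h4 := conjTranspose_mul_spinRaise n
  have hI : (1 / (2 * Complex.I) : ℂ) = -(Complex.I / 2) := by
    field_simp; simp
  have key : ∑ a, spinX n a * spinX n a =
      (1 / 2 : ℂ) • (spinRaise n * (spinRaise n).conjTranspose +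
        (spinRaise n).conjTranspose * spinRaise n) + spinX n 2 * spinX n 2 := by
    rw [Fin.sum_univ_three, spinX_zero, spinX_one, hI]
    generalize spinRaise n = R at *
    generalize R.conjTranspose = S at *
    have : -(Complex.I / 2) * -(Complex.I / 2) = -(1 / 4 : ℂ) := by
      ring_nf; rw [Complex.I_sq]; ring
    simp only [smul_mul_smul_comm, this, add_mul, mul_add, sub_mul, mul_sub]
    module
  rw [key, h3, h4, spinX_two, Matrix.diagonal_mul_diagonal, Matrix.diagonal_add,
    ← Matrix.diagonal_one, ← Matrix.diagonal_smul, ← Matrix.diagonal_smul, Matrix.diagonal_add]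
  congr 1
  funext k
  simp only [Pi.smul_apply, smul_eq_mul]
  ring

/-! ### Schur's lemma for scalar and vector operators -/

/-- An intertwiner from `[m / 2]` is determined by the image of the highest weight vector. -/
theorem eq_zero_of_lower_intertwining {ι : Type} [Fintype ι] {m : ℕ} {L : Matrix ι ι ℂ}
    {τ : Matrix ι (Fin (m + 1)) ℂ} (h : L * τ = τ * (spinRaise m).conjTranspose)
    (h0 : ∀ s, τ s 0 = 0) : τ = 0 := by
  have key : ∀ k (hk : k < m + 1), ∀ s, τ s ⟨k, hk⟩ = 0 := by
    intro k
    induction k with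
    | zero => intro hk s; exact h0 s
    -- Column `k` of the intertwining relation expresses column `k + 1` of `τ`, times a nonzero
    -- ladder element, through column `k`.
    | succ k ih =>
      intro hk s
      have h1 := congrFun (congrFun h s) ⟨k, by omega⟩
      simp only [Matrix.mul_apply, Matrix.conjTranspose_apply, star_spinRaise_apply] at h1
      rw [Finset.sum_eq_zero fun t _ => by rw [ih, mul_zero]] at h1
      simp_rw [mul_comm (τ s _)] at h1
      rw [sum_spinRaise_mul, dif_pos hk] at h1
      have := ladder_ne_zero (n := m) (k := k) (by omega)
      simpa [this] using h1.symm
  ext s ⟨k, hk⟩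
  exact key k hk s

/-- Commuting with `X₂` confines the first column of `M` to its top entry, since weights are
distinct. So `M - M 0 0` is an intertwiner that kills the highest weight vector. -/
theorem exists_eq_smul_one {n : ℕ} {M : Alg n} (h : ∀ a, spinX n a * M = M * spinX n a) :
    ∃ c : ℂ, M = c • (1 : Alg n) := by
  refine ⟨M 0 0, ?_⟩
  rw [← sub_eq_zero]
  refine eq_zero_of_lower_intertwining (L := (spinRaise n).conjTranspose) ?_ ?_
  · rw [mul_sub, sub_mul, mul_smul_comm, smul_mul_assoc, one_mul, mul_one, ← spinX_zero_sub,
      sub_mul, mul_sub, smul_mul_assoc, mul_smul_comm, h, h]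
  · intro s
    have h2 := congrFun (congrFun (h 2) s) 0
    rw [spinX_two, Matrix.diagonal_mul, Matrix.mul_diagonal] at h2
    by_cases hs : s = 0
    · subst hs; simp
    · have hs' : ((s : ℕ) : ℂ) ≠ 0 := Nat.cast_ne_zero.2 fun hc => hs (Fin.ext hc)
      have : ((s : ℕ) : ℂ) * M s 0 = 0 := by
        simp only [Fin.coe_ofNat_eq_mod, Nat.zero_mod, Nat.cast_zero, sub_zero] at h2
        linear_combination -h2
      have := (mul_eq_zero.1 this).resolve_left hs'
      rw [Matrix.sub_apply, this, Matrix.smul_apply, Matrix.one_apply_ne hs, smul_zero, sub_zero]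

/-- Wigner–Eckart for spin one: `V₊` raises the weight by one, so it lives on the superdiagonal, and
commuting with `X₊` makes its ratio to the ladder elements constant. Then `V - κ X` has no raising
component and vanishes by `IsVectorOperator.eq_zero`. -/
theorem IsVectorOperator.exists_eq_smul {n : ℕ} {V : Fin 3 → Alg n}
    (h : IsVectorOperator (spinX n) V) : ∃ κ : ℂ, V = κ • spinX n := by
  have h1 := h.lie_two_raise
  have h2 := h.lie_raise_raise
  rw [spinX_zero_add] at h2
  set R := V 0 + Complex.I • V 1 with hR
  have hsupp : ∀ i j : Fin (n + 1), (i : ℕ) + 1 ≠ j → R i j = 0 := by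
    intro i j hij
    have e := congrFun (congrFun h1 i) j
    rw [spinX_two, Matrix.sub_apply, Matrix.diagonal_mul, Matrix.mul_diagonal] at e
    have hs : (((j : ℕ) : ℂ) - ((i : ℕ) + 1 : ℕ)) ≠ 0 := by
      rw [sub_ne_zero]; exact_mod_cast hij.symm
    refine (mul_eq_zero.1 (?_ : _ * R i j = 0)).resolve_left hs
    push_cast
    linear_combination e
  suffices ∃ κ : ℂ, R = κ • spinRaise n by
    obtain ⟨κ, hκ⟩ := this
    refine ⟨κ, sub_eq_zero.1 ?_⟩
    refine (h.sub ((isVectorOperator_spinX n).smul κ)).eq_zero ?_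
    have : R - κ • (spinX n 0 + Complex.I • spinX n 1) = 0 := by
      rw [spinX_zero_add, hκ, sub_self]
    rw [← this, hR]
    simp only [Pi.sub_apply, Pi.smul_apply]
    module
  have hrec : ∀ k (hk : k + 2 < n + 1), (ladder n k : ℂ) * R ⟨k + 1, by omega⟩ ⟨k + 2, hk⟩ =
      R ⟨k, by omega⟩ ⟨k + 1, by omega⟩ * ladder n (k + 1) := by
    intro k hk
    have e := congrFun (congrFun h2 ⟨k, by omega⟩) ⟨k + 2, hk⟩
    rw [Matrix.mul_apply, Matrix.mul_apply, sum_mul_spinRaise, sum_spinRaise_mul, dif_pos] at e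
    exact e
  -- Spin zero has no superdiagonal, hence no entry `R 0 1` to read the constant from; any constant
  -- serves.
  obtain _ | n := n
  · refine ⟨0, ?_⟩
    ext i j
    rw [hsupp i j (by have := j.2; omega)]
    simp
  refine ⟨R 0 1 / ladder (n + 1) 0, ?_⟩
  have key : ∀ k (hk : k + 1 < n + 1 + 1), R ⟨k, by omega⟩ ⟨k + 1, hk⟩ =
      R 0 1 / ladder (n + 1) 0 * ladder (n + 1) k := by
    intro k
    induction k with
    | zero =>
      intro hk
      have := ladder_ne_zero (n := n + 1) (k := 0) (by omega)
      have : (ladder (n + 1) 0 : ℂ) ≠ 0 := by exact_mod_cast this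
      rw [div_mul_cancel₀ _ this]
      rfl
    | succ k ih =>
      intro hk
      have e := hrec k hk
      rw [ih (by omega)] at e
      have := ladder_ne_zero (n := n + 1) (k := k) (by omega)
      have : (ladder (n + 1) k : ℂ) ≠ 0 := by exact_mod_cast this
      apply mul_left_cancel₀ this
      rw [e]; ring
  ext ⟨i, hi⟩ ⟨j, hj⟩
  rw [Matrix.smul_apply, smul_eq_mul, spinRaise_apply]
  split_ifs with hij
  · simp only at hij
    subst hij
    exact key i hj
  · rw [hsupp _ _ hij, mul_zero]

/-! ### Representations generated by highest weight vectors -/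

section HighestWeight

variable {ι : Type} [Fintype ι]

theorem intertwining_of_ladder {x : Fin 3 → Matrix ι ι ℂ} {m : ℕ} {τ : Matrix ι (Fin (m + 1)) ℂ}
    (hE : (x 0 + Complex.I • x 1) * τ = τ * spinRaise m)
    (hF : (x 0 - Complex.I • x 1) * τ = τ * (spinRaise m).conjTranspose)
    (hH : x 2 * τ = τ * spinX m 2) (a : Fin 3) : x a * τ = τ * spinX m a := by
  have hI : (1 / (2 * Complex.I) : ℂ) = -(Complex.I / 2) := by
    field_simp; simp
  fin_cases a
  · simp only [Fin.zero_eta]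
    rw [spinX_zero, Matrix.mul_smul, Matrix.mul_add, ← hE, ← hF, ← Matrix.add_mul]
    rw [← Matrix.smul_mul]
    congr 1
    module
  · simp only [Fin.mk_one]
    rw [spinX_one, Matrix.mul_smul, Matrix.mul_sub, ← hE, ← hF, ← Matrix.sub_mul]
    rw [← Matrix.smul_mul, hI]
    congr 1
    rw [show x 0 + Complex.I • x 1 - (x 0 - Complex.I • x 1) = (2 * Complex.I) • x 1 by module,
      smul_smul]
    rw [show -(Complex.I / 2) * (2 * Complex.I) = -(Complex.I * Complex.I) by ring]
    simp
  · exact hH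

/-- The vectors obtained from a highest weight vector by lowering. -/
theorem weight_of_lower [DecidableEq ι] {x : Fin 3 → Matrix ι ι ℂ} (hx : IsVectorOperator x x)
    {m : ℂ} {v : ι → ℂ} (hw : (x 2).mulVec v = (m / 2) • v) (k : ℕ) :
    (x 2).mulVec (((x 0 - Complex.I • x 1) ^ k).mulVec v) =
      (m / 2 - k) • ((x 0 - Complex.I • x 1) ^ k).mulVec v := by
  have hl := hx.lie_two_lower
  set F := x 0 - Complex.I • x 1
  induction k with
  | zero => simpa using hw
  | succ k ih =>
    have : x 2 * F = F * x 2 - F := by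
      rw [← sub_eq_zero, ← sub_eq_zero.2 hl]; abel
    rw [pow_succ', ← Matrix.mulVec_mulVec, Matrix.mulVec_mulVec, this, Matrix.sub_mulVec,
      ← Matrix.mulVec_mulVec, ih, Matrix.mulVec_smul]
    push_cast
    module

/-- Each passage of the raising operator past a lowering operator costs `2 x₂`. The weights met on
the way add up to `∑_{i ≤ k} (m - 2 i) = (k + 1)(m - k)`. -/
theorem raise_lower_pow [DecidableEq ι] {x : Fin 3 → Matrix ι ι ℂ} (hx : IsVectorOperator x x)
    {m : ℂ} {v : ι → ℂ} (hv : (x 0 + Complex.I • x 1).mulVec v = 0)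
    (hw : (x 2).mulVec v = (m / 2) • v) (k : ℕ) :
    (x 0 + Complex.I • x 1).mulVec (((x 0 - Complex.I • x 1) ^ (k + 1)).mulVec v) =
      (((k : ℂ) + 1) * (m - k)) • ((x 0 - Complex.I • x 1) ^ k).mulVec v := by
  have hl := hx.lie_raise_lower
  have hwk := weight_of_lower hx hw
  set F := x 0 - Complex.I • x 1
  set E := x 0 + Complex.I • x 1
  have hEF : E * F = F * E + (2 : ℂ) • x 2 := by rw [← hl]; abel
  induction k with
  | zero =>
    rw [pow_succ', ← Matrix.mulVec_mulVec, Matrix.mulVec_mulVec, hEF, Matrix.add_mulVec,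
      ← Matrix.mulVec_mulVec, Matrix.smul_mulVec, hwk]
    simp [hv, smul_smul]
    congr 1
    ring
  | succ k ih =>
    rw [pow_succ', ← Matrix.mulVec_mulVec, Matrix.mulVec_mulVec, hEF, Matrix.add_mulVec,
      ← Matrix.mulVec_mulVec, ih, Matrix.smul_mulVec, hwk, Matrix.mulVec_smul,
      Matrix.mulVec_mulVec, ← pow_succ', smul_smul, ← add_smul]
    congr 1
    push_cast
    ring

-- With `F` lowering and `E = F*` raising, `‖F^(m+1) v‖² = ⟨F^m v, E F^(m+1) v⟩`, and the
-- coefficient in `raise_lower_pow` is zero at `k = m`. Hermiticity thus ends the chain without any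
-- prior irreducibility.
open scoped ComplexOrder in
theorem lower_pow_eq_zero [DecidableEq ι] {x : Fin 3 → Matrix ι ι ℂ} (hx : IsVectorOperator x x)
    (hh : ∀ a, (x a).conjTranspose = x a) {m : ℕ} {v : ι → ℂ}
    (hv : (x 0 + Complex.I • x 1).mulVec v = 0) (hw : (x 2).mulVec v = ((m : ℂ) / 2) • v) :
    ((x 0 - Complex.I • x 1) ^ (m + 1)).mulVec v = 0 := by
  have h := raise_lower_pow hx hv hw m
  rw [sub_self, mul_zero, zero_smul] at h
  rw [← dotProduct_star_self_eq_zero]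
  have hF : (x 0 + Complex.I • x 1).conjTranspose = x 0 - Complex.I • x 1 := by
    rw [Matrix.conjTranspose_add, Matrix.conjTranspose_smul, hh, hh]
    simp [sub_eq_add_neg]
  set F := x 0 - Complex.I • x 1
  have e : (F ^ (m + 1)).mulVec v = F.mulVec ((F ^ m).mulVec v) := by
    rw [pow_succ', Matrix.mulVec_mulVec]
  calc _ = star (F.mulVec ((F ^ m).mulVec v)) ⬝ᵥ (F ^ (m + 1)).mulVec v := by rw [← e]
    _ = 0 := by
      rw [Matrix.star_mulVec, ← hF, Matrix.conjTranspose_conjTranspose,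
        ← Matrix.dotProduct_mulVec, hF, h, dotProduct_zero]

/-- A highest weight vector of weight `m / 2` generates a representation of spin `m / 2`. -/
theorem exists_intertwining_of_highestWeight [DecidableEq ι] {x : Fin 3 → Matrix ι ι ℂ}
    (hx : IsVectorOperator x x) (hh : ∀ a, (x a).conjTranspose = x a) {m : ℕ} {v : ι → ℂ}
    (hv : (x 0 + Complex.I • x 1).mulVec v = 0) (hw : (x 2).mulVec v = ((m : ℂ) / 2) • v) :
    ∃ τ : Matrix ι (Fin (m + 1)) ℂ, (∀ a, x a * τ = τ * spinX m a) ∧ ∀ s, τ s 0 = v s := by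
  have hEk := raise_lower_pow hx hv hw
  have hHk := weight_of_lower hx hw
  have h0 := lower_pow_eq_zero hx hh hv hw
  -- These factors rescale the chain of lowered vectors so that the lowering operator acts on it
  -- with exactly the matrix elements `ladder m k`.
  set c : ℕ → ℂ := fun k => ∏ i ∈ Finset.range k, (ladder m i : ℂ)⁻¹ with hc
  have hck : ∀ k, k < m → c (k + 1) * ladder m k = c k := by
    intro k hk
    have : (ladder m k : ℂ) ≠ 0 := by exact_mod_cast ladder_ne_zero hk
    simp only [hc, Finset.prod_range_succ]
    rw [inv_mul_cancel_right₀ this]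
  obtain ⟨τ, hτ⟩ : ∃ τ : Matrix ι (Fin (m + 1)) ℂ,
      ∀ s k, τ s k = c k * ((x 0 - Complex.I • x 1) ^ (k : ℕ)).mulVec v s :=
    ⟨Matrix.of fun s k => c k * ((x 0 - Complex.I • x 1) ^ (k : ℕ)).mulVec v s, fun _ _ => rfl⟩
  refine ⟨τ, ?_, ?_⟩
  · have hcol : ∀ (M : Matrix ι ι ℂ) (k : Fin (m + 1)) s,
        (M * τ) s k = c k * M.mulVec (((x 0 - Complex.I • x 1) ^ (k : ℕ)).mulVec v) s := by
      intro M k s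
      rw [Matrix.mul_apply, Matrix.mulVec, dotProduct, Finset.mul_sum]
      refine Finset.sum_congr rfl fun t _ => ?_
      rw [hτ]
      ring
    apply intertwining_of_ladder
    · ext s ⟨k, hk⟩
      rw [hcol, Matrix.mul_apply]
      simp only [hτ]
      obtain _ | k := k
      · have := sum_mul_spinRaise_zero m
          fun k => c k * ((x 0 - Complex.I • x 1) ^ (k : ℕ)).mulVec v s
        rw [show (⟨0, hk⟩ : Fin (m + 1)) = 0 from rfl, this]
        simp [hv]
      · have := sum_mul_spinRaise m k hk
          fun k => c k * ((x 0 - Complex.I • x 1) ^ (k : ℕ)).mulVec v s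
        rw [this, hEk, Pi.smul_apply, smul_eq_mul, ← hck k (by omega)]
        have := ladder_mul_self (n := m) (k := k) (by omega)
        have : (ladder m k : ℂ) * ladder m k = ((k : ℂ) + 1) * ((m : ℂ) - k) := by
          exact_mod_cast this
        simp only
        rw [← this]
        ring
    · ext s ⟨k, hk⟩
      rw [hcol, Matrix.mul_apply]
      simp only [hτ]
      simp only [Matrix.conjTranspose_apply, star_spinRaise_apply]
      simp_rw [mul_comm _ (spinRaise m _ _)]
      rw [sum_spinRaise_mul, Matrix.mulVec_mulVec, ← pow_succ']
      split_ifs with h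
      · rw [← hck k (by simp only at h; omega)]
        ring
      -- The last column closes up only because `m + 1` lowerings annihilate `v`.
      · simp only at h
        have : k = m := by omega
        subst this
        rw [h0]
        simp
    · ext s k
      rw [hcol, spinX_two, Matrix.mul_diagonal, hτ, hHk, Pi.smul_apply, smul_eq_mul]
      ring
  · intro s
    simp [hc, hτ]

end HighestWeight

/-! ### The tensor product of two spin representations -/

/-- The generators acting on the first factor of the tensor product. -/
def leftX (n l : ℕ) (a : Fin 3) :
    Matrix (Fin (n + 1) × Fin (l + 1)) (Fin (n + 1) × Fin (l + 1)) ℂ :=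
  spinX n a ⊗ₖ (1 : Alg l)

/-- The generators acting on the second factor of the tensor product. -/
def rightX (n l : ℕ) (a : Fin 3) :
    Matrix (Fin (n + 1) × Fin (l + 1)) (Fin (n + 1) × Fin (l + 1)) ℂ :=
  (1 : Alg n) ⊗ₖ spinX l a

theorem tensorX_eq (n l : ℕ) (a : Fin 3) : tensorX n l a = leftX n l a + rightX n l a := rfl

theorem leftX_mul_rightX (n l : ℕ) (a b : Fin 3) :
    leftX n l a * rightX n l b = rightX n l b * leftX n l a := by
  simp [leftX, rightX, ← Matrix.mul_kronecker_mul]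

theorem isVectorOperator_rightX (n l : ℕ) : IsVectorOperator (rightX n l) (rightX n l) := by
  intro a b
  have h := sub_eq_iff_eq_add.1 (isVectorOperator_spinX l a b)
  rw [sub_eq_iff_eq_add]
  simp only [rightX, ← Matrix.mul_kronecker_mul, mul_one, h, Fin.sum_univ_three,
    Matrix.kronecker_add, Matrix.kronecker_smul]

theorem isVectorOperator_leftX (n l : ℕ) : IsVectorOperator (leftX n l) (leftX n l) := by
  intro a b
  have h := sub_eq_iff_eq_add.1 (isVectorOperator_spinX n a b)
  rw [sub_eq_iff_eq_add]
  simp only [leftX, ← Matrix.mul_kronecker_mul, mul_one, h, Fin.sum_univ_three,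
    Matrix.add_kronecker, Matrix.smul_kronecker]

theorem isVectorOperator_tensorX_rightX (n l : ℕ) :
    IsVectorOperator (tensorX n l) (rightX n l) := by
  intro a b
  rw [← isVectorOperator_rightX n l a b, tensorX_eq, add_mul, mul_add, leftX_mul_rightX]
  abel

theorem isVectorOperator_tensorX_leftX (n l : ℕ) :
    IsVectorOperator (tensorX n l) (leftX n l) := by
  intro a b
  rw [← isVectorOperator_leftX n l a b, tensorX_eq, add_mul, mul_add, leftX_mul_rightX]
  abel

theorem isVectorOperator_tensorX (n l : ℕ) : IsVectorOperator (tensorX n l) (tensorX n l) := by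
  intro a b
  have h1 := isVectorOperator_tensorX_leftX n l a b
  have h2 := isVectorOperator_tensorX_rightX n l a b
  calc _ = (tensorX n l a * leftX n l b - leftX n l b * tensorX n l a) +
        (tensorX n l a * rightX n l b - rightX n l b * tensorX n l a) := by
          rw [tensorX_eq n l b]; noncomm_ring
    _ = _ := by
      rw [h1, h2, ← Finset.sum_add_distrib]
      exact Finset.sum_congr rfl fun c _ => by rw [tensorX_eq, smul_add]

theorem tensorX_isHermitian (n l : ℕ) (a : Fin 3) :
    (tensorX n l a).conjTranspose = tensorX n l a := by
  simp [tensorX, Matrix.conjTranspose_kronecker, spinX_isHermitian]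

theorem tensorX_raise (n l : ℕ) : tensorX n l 0 + Complex.I • tensorX n l 1 =
    spinRaise n ⊗ₖ (1 : Alg l) + (1 : Alg n) ⊗ₖ spinRaise l := by
  rw [← spinX_zero_add, ← spinX_zero_add, Matrix.add_kronecker, Matrix.kronecker_add,
    Matrix.smul_kronecker, Matrix.kronecker_smul, tensorX, tensorX]
  module

theorem tensorX_raise_mulVec (n l : ℕ) (v : Fin (n + 1) × Fin (l + 1) → ℂ) (i : Fin (n + 1))
    (j : Fin (l + 1)) : (tensorX n l 0 + Complex.I • tensorX n l 1).mulVec v (i, j) =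
      (if h : (i : ℕ) + 1 < n + 1 then (ladder n i : ℂ) * v (⟨i + 1, h⟩, j) else 0) +
      (if h : (j : ℕ) + 1 < l + 1 then (ladder l j : ℂ) * v (i, ⟨j + 1, h⟩) else 0) := by
  rw [tensorX_raise, Matrix.add_mulVec, Pi.add_apply, ← sum_spinRaise_mul n i fun i' => v (i', j),
    ← sum_spinRaise_mul l j fun j' => v (i, j')]
  simp only [Matrix.mulVec, dotProduct, Fintype.sum_prod_type, Matrix.kroneckerMap_apply,
    Matrix.one_apply]
  simp

theorem tensorX_two_mulVec (n l : ℕ) (v : Fin (n + 1) × Fin (l + 1) → ℂ) (i : Fin (n + 1))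
    (j : Fin (l + 1)) : (tensorX n l 2).mulVec v (i, j) =
      ((n : ℂ) / 2 - (i : ℕ) + ((l : ℂ) / 2 - (j : ℕ))) * v (i, j) := by
  rw [tensorX, spinX_two, spinX_two, ← Matrix.diagonal_one, ← Matrix.diagonal_one,
    Matrix.diagonal_kronecker_diagonal, Matrix.diagonal_kronecker_diagonal, Matrix.diagonal_add,
    Matrix.mulVec_diagonal]
  simp

/-- The highest weight vector of weight `(n + l) / 2 - r` in `[n / 2] ⊗ [l / 2]`. -/
def topVec (n l r : ℕ) : Fin (n + 1) × Fin (l + 1) → ℂ := fun p =>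
  if (p.1 : ℕ) + p.2 = r then
    ∏ k ∈ Finset.range p.1, -((ladder l (r - 1 - k) : ℂ) / (ladder n k : ℂ)) else 0

/-- At `(i, j)` with `i + 1 + j = r` the two contributions cancel because consecutive entries of
`topVec` have ratio `-ladder l j / ladder n i`; this dictates its product formula. The bounds on `r`
keep both neighbours in range. -/
theorem topVec_raise (n l r : ℕ) (hn : r ≤ n) (hl : r ≤ l) :
    (tensorX n l 0 + Complex.I • tensorX n l 1).mulVec (topVec n l r) = 0 := by
  funext ⟨i, j⟩
  rw [tensorX_raise_mulVec]
  simp only [topVec, Pi.zero_apply]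
  by_cases h : (i : ℕ) + 1 + j = r
  · rw [dif_pos (by omega), dif_pos (by omega), if_pos h, if_pos (by omega),
      Finset.prod_range_succ]
    have : (ladder n i : ℂ) ≠ 0 := by exact_mod_cast ladder_ne_zero (by omega)
    rw [show r - 1 - (i : ℕ) = j by omega]
    field_simp
    ring
  · rw [if_neg h, if_neg (by omega)]
    simp

theorem topVec_weight (n l m r : ℕ) (h : m + 2 * r = n + l) :
    (tensorX n l 2).mulVec (topVec n l r) = ((m : ℂ) / 2) • topVec n l r := by
  funext ⟨i, j⟩
  rw [tensorX_two_mulVec, Pi.smul_apply, smul_eq_mul, topVec]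
  split_ifs with hr
  · congr 1
    have h1 : (m : ℂ) + 2 * r = n + l := by exact_mod_cast h
    have h2 : ((i : ℕ) : ℂ) + (j : ℕ) = r := by exact_mod_cast hr
    linear_combination -h1 / 2 - h2
  · simp

theorem topVec_apply_zero (n l r : ℕ) (hl : r ≤ l) : topVec n l r (0, ⟨r, by omega⟩) = 1 := by
  simp [topVec]

/-- Multiplicity one: the weight confines `w` to the antidiagonal `i + j = r`, and annihilation by
the raising operator is a two-term recursion that carries the zero at `i = 0` along it. -/
theorem highestWeight_eq_zero (n l m r : ℕ) (h : m + 2 * r = n + l) (hl : r ≤ l)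
    {w : Fin (n + 1) × Fin (l + 1) → ℂ}
    (hE : (tensorX n l 0 + Complex.I • tensorX n l 1).mulVec w = 0)
    (hH : (tensorX n l 2).mulVec w = ((m : ℂ) / 2) • w) (h0 : w (0, ⟨r, by omega⟩) = 0) :
    w = 0 := by
  have hsupp : ∀ (i : Fin (n + 1)) (j : Fin (l + 1)), (i : ℕ) + (j : ℕ) ≠ r → w (i, j) = 0 := by
    intro i j hij
    have e := congrFun hH (i, j)
    rw [tensorX_two_mulVec, Pi.smul_apply, smul_eq_mul] at e
    have h1 : (m : ℂ) + 2 * r = n + l := by exact_mod_cast h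
    have hs : (r : ℂ) - ((i : ℕ) + (j : ℕ) : ℕ) ≠ 0 := by
      rw [sub_ne_zero]; exact_mod_cast hij.symm
    refine (mul_eq_zero.1 (?_ : _ * w (i, j) = 0)).resolve_left hs
    push_cast
    linear_combination e + w (i, j) * h1 / 2
  have key : ∀ i j (hi : i < n + 1) (hj : j < l + 1), i + j = r →
      w (⟨i, hi⟩, ⟨j, hj⟩) = 0 := by
    intro i
    induction i with
    | zero =>
      intro j hi hj hij
      have : j = r := by omega
      subst this
      exact h0
    | succ i ih =>
      intro j hi hj hij
      have e := congrFun hE (⟨i, by omega⟩, ⟨j, hj⟩)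
      rw [tensorX_raise_mulVec, dif_pos hi, dif_pos (by simp only; omega)] at e
      simp only at e
      rw [ih (j + 1) _ _ (by omega), mul_zero, add_zero, Pi.zero_apply] at e
      have : (ladder n i : ℂ) ≠ 0 := by exact_mod_cast ladder_ne_zero (by omega)
      exact (mul_eq_zero.1 e).resolve_left this
  funext ⟨i, j⟩
  by_cases hij : (i : ℕ) + (j : ℕ) = r
  · exact key i j i.2 j.2 hij
  · exact hsupp i j hij

/-- The first column of an intertwiner is a highest weight vector, so one entry decides whether it
vanishes; lowering then handles the other columns. -/
theorem intertwining_eq_zero (n l m r : ℕ) (h : m + 2 * r = n + l) (hl : r ≤ l)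
    {τ : Matrix (Fin (n + 1) × Fin (l + 1)) (Fin (m + 1)) ℂ}
    (hτ : ∀ a, tensorX n l a * τ = τ * spinX m a) (h0 : τ (0, ⟨r, by omega⟩) 0 = 0) : τ = 0 := by
  have hmv : ∀ M : Matrix (Fin (n + 1) × Fin (l + 1)) (Fin (n + 1) × Fin (l + 1)) ℂ,
      M.mulVec (fun s => τ s 0) = fun s => (M * τ) s 0 := fun M => by
    funext s; rw [Matrix.mul_apply]; rfl
  have hz : (fun s => τ s 0) = 0 := by
    refine highestWeight_eq_zero n l m r h hl ?_ ?_ h0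
    · rw [hmv, Matrix.add_mul, Matrix.smul_mul, hτ, hτ, ← Matrix.mul_smul, ← Matrix.mul_add,
        spinX_zero_add]
      funext s
      rw [Matrix.mul_apply, sum_mul_spinRaise_zero]
      rfl
    · rw [hmv, hτ, spinX_two]
      funext s
      rw [Matrix.mul_diagonal, Pi.smul_apply, smul_eq_mul]
      simp [mul_comm]
  refine eq_zero_of_lower_intertwining (L := tensorX n l 0 - Complex.I • tensorX n l 1) ?_
    fun s => congrFun hz s
  rw [Matrix.sub_mul, Matrix.smul_mul, hτ, hτ, ← Matrix.mul_smul, ← Matrix.mul_sub, spinX_zero_sub]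

/-- Up to scalars there is exactly one intertwiner from `[m / 2]` to `[n / 2] ⊗ [l / 2]`, and it
can be chosen isometric. -/
theorem exists_isometric_intertwining (n l m r : ℕ) (h : m + 2 * r = n + l) (hn : r ≤ n)
    (hl : r ≤ l) : ∃ τ : Matrix (Fin (n + 1) × Fin (l + 1)) (Fin (m + 1)) ℂ,
      τ.conjTranspose * τ = 1 ∧ (∀ a, tensorX n l a * τ = τ * spinX m a) ∧
      ∀ τ' : Matrix (Fin (n + 1) × Fin (l + 1)) (Fin (m + 1)) ℂ,
        (∀ a, tensorX n l a * τ' = τ' * spinX m a) → ∃ c : ℂ, τ' = c • τ := by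
  obtain ⟨τ, hτ, hτ0⟩ := exists_intertwining_of_highestWeight (isVectorOperator_tensorX n l)
    (tensorX_isHermitian n l) (topVec_raise n l r hn hl) (topVec_weight n l m r h)
  have h1 : τ (0, ⟨r, by omega⟩) 0 = 1 := by rw [hτ0, topVec_apply_zero n l r hl]
  have hτs : ∀ a, τ.conjTranspose * tensorX n l a = spinX m a * τ.conjTranspose := by
    intro a
    have := congrArg Matrix.conjTranspose (hτ a)
    rwa [Matrix.conjTranspose_mul, Matrix.conjTranspose_mul, tensorX_isHermitian,
      spinX_isHermitian] at this
  obtain ⟨c, hc⟩ := exists_eq_smul_one (M := τ.conjTranspose * τ) fun a => by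
    rw [← Matrix.mul_assoc, ← hτs, Matrix.mul_assoc, Matrix.mul_assoc, hτ]
  -- By Schur, `τ* τ` is the scalar `c`, which must be the squared norm of the first column. It is
  -- positive since the column has an entry `1`.
  set R : ℝ := ∑ s, ‖τ s 0‖ ^ 2 with hR
  have hcR : c = (R : ℂ) := by
    have e := congrFun (congrFun hc 0) 0
    rw [Matrix.mul_apply, Matrix.smul_apply, Matrix.one_apply_eq, smul_eq_mul, mul_one] at e
    rw [← e, hR]
    push_cast
    refine Finset.sum_congr rfl fun s _ => ?_
    rw [Matrix.conjTranspose_apply]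
    exact Complex.conj_mul' _
  have hRpos : 0 < R := by
    refine Finset.sum_pos' (fun s _ => by positivity) ⟨(0, ⟨r, by omega⟩), Finset.mem_univ _, ?_⟩
    rw [h1]
    simp
  have hsq : (Real.sqrt R : ℂ) * Real.sqrt R = R := by
    rw [← Complex.ofReal_mul, Real.mul_self_sqrt hRpos.le]
  have hs0 : (Real.sqrt R : ℂ) ≠ 0 := by
    exact_mod_cast (Real.sqrt_pos.2 hRpos).ne'
  refine ⟨(Real.sqrt R : ℂ)⁻¹ • τ, ?_, ?_, ?_⟩
  · rw [Matrix.conjTranspose_smul, Matrix.smul_mul, Matrix.mul_smul, hc, smul_smul, smul_smul,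
      hcR, ← hsq, Complex.star_def, map_inv₀, Complex.conj_ofReal]
    rw [show (Real.sqrt R : ℂ)⁻¹ * (Real.sqrt R : ℂ)⁻¹ * (Real.sqrt R * Real.sqrt R) = 1 by
      field_simp, one_smul]
  · intro a
    rw [Matrix.mul_smul, Matrix.smul_mul, hτ]
  · intro τ' hτ'
    -- The scalar makes the difference vanish at the test entry, where the unnormalized `τ` is `1`.
    refine ⟨τ' (0, ⟨r, by omega⟩) 0 * Real.sqrt R, ?_⟩
    rw [smul_smul, mul_inv_cancel_right₀ hs0, ← sub_eq_zero]
    refine intertwining_eq_zero n l m r h hl (fun a => ?_) ?_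
    · rw [Matrix.mul_sub, Matrix.sub_mul, Matrix.mul_smul, Matrix.smul_mul, hτ, hτ']
    · simp [h1]

/-! ### The projection onto an irreducible component -/

section Projector

variable {n l m : ℕ} {τ : Matrix (Fin (n + 1) × Fin (l + 1)) (Fin (m + 1)) ℂ}

/-- Every embedding of `[m/2]` is a nonzero multiple of `τ`, so all of them have the same image. -/
theorem isSpinSubrep_iff (h1 : τ.conjTranspose * τ = 1)
    (hτ : ∀ a, tensorX n l a * τ = τ * spinX m a)
    (hu : ∀ τ' : Matrix (Fin (n + 1) × Fin (l + 1)) (Fin (m + 1)) ℂ,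
        (∀ a, tensorX n l a * τ' = τ' * spinX m a) → ∃ c : ℂ, τ' = c • τ)
    (W : Submodule ℂ (TensorSpace n l)) :
    IsSpinSubrep n l m W ↔ W = LinearMap.range τ.toEuclideanLin := by
  constructor
  · rintro ⟨T, hT, rfl, hTX⟩
    obtain ⟨τ', rfl⟩ := (Matrix.toEuclideanLin (𝕜 := ℂ)).surjective T
    obtain ⟨c, rfl⟩ := hu τ' fun a => by
      apply (Matrix.toEuclideanLin (𝕜 := ℂ)).injective
      rw [Matrix.toEuclideanLin, Matrix.toLpLin_mul_same, Matrix.toLpLin_mul_same]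
      exact LinearMap.ext fun v => (hTX a v).symm
    have hc : c ≠ 0 := by
      rintro rfl
      have h0 := @hT (EuclideanSpace.single 0 1) 0 (by simp)
      have := congrArg (fun v : SpinSpace m => v 0) h0
      simp at this
    rw [map_smul, LinearMap.range_smul _ _ hc]
  · rintro rfl
    refine ⟨τ.toEuclideanLin, ?_, rfl, fun a v => ?_⟩
    · have : τ.conjTranspose.toEuclideanLin ∘ₗ τ.toEuclideanLin = LinearMap.id := by
        rw [Matrix.toEuclideanLin, ← Matrix.toLpLin_mul_same, h1, Matrix.toLpLin_one]
      exact Function.LeftInverse.injective (g := τ.conjTranspose.toEuclideanLin)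
        fun v => LinearMap.congr_fun this v
    · have := congrArg (Matrix.toEuclideanLin (𝕜 := ℂ)) (hτ a)
      rw [Matrix.toEuclideanLin, Matrix.toLpLin_mul_same, Matrix.toLpLin_mul_same] at this
      exact (LinearMap.congr_fun this v).symm

theorem starProjection_range (h1 : τ.conjTranspose * τ = 1) {W : Submodule ℂ (TensorSpace n l)}
    [W.HasOrthogonalProjection] (hW : W = LinearMap.range τ.toEuclideanLin)
    (u : TensorSpace n l) :
    W.starProjection u = (τ * τ.conjTranspose).toEuclideanLin u := by
  have hmul : (τ * τ.conjTranspose).toEuclideanLin u =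
      τ.toEuclideanLin (τ.conjTranspose.toEuclideanLin u) := by
    rw [Matrix.toEuclideanLin, Matrix.toLpLin_mul_same]; rfl
  have hid (v : SpinSpace m) : τ.conjTranspose.toEuclideanLin (τ.toEuclideanLin v) = v := by
    have : τ.conjTranspose.toEuclideanLin ∘ₗ τ.toEuclideanLin = LinearMap.id := by
      rw [Matrix.toEuclideanLin, ← Matrix.toLpLin_mul_same, h1, Matrix.toLpLin_one]
    exact LinearMap.congr_fun this v
  apply Submodule.eq_starProjection_of_mem_of_inner_eq_zero
  · rw [hmul, hW]
    exact LinearMap.mem_range_self _ _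
  · intro w' hw
    rw [hW] at hw
    obtain ⟨w, rfl⟩ := hw
    rw [← LinearMap.adjoint_inner_left, ← Matrix.toEuclideanLin_conjTranspose_eq_adjoint, map_sub,
      hmul, hid, sub_self, inner_zero_left]

/-- The blocks of an operator on the tensor product, with entries acting on the first factor. -/
def blocks (M : Matrix (Fin (n + 1) × Fin (l + 1)) (Fin (n + 1) × Fin (l + 1)) ℂ) :
    Matrix (Fin (l + 1)) (Fin (l + 1)) (Alg n) := fun i j =>
  Matrix.of fun s t => M (s, i) (t, j)

theorem fuzzyProjector_eq (h1 : τ.conjTranspose * τ = 1)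
    (h : spinComponent n l m = LinearMap.range τ.toEuclideanLin) :
    fuzzyProjector n l m = blocks (τ * τ.conjTranspose) := by
  funext i j
  ext s t
  rw [fuzzyProjector, blocks, Matrix.of_apply, Matrix.of_apply, starProjection_range h1 h]
  simp only [Matrix.ofLp_toLpLin, Matrix.toLin'_apply, PiLp.ofLp_single, Matrix.mulVec_single_one]
  rfl

end Projector

/-! ### Partial traces -/

section PartialTrace

variable {n l : ℕ}

/-- The trace over the second tensor factor. -/
def partialTrace : Matrix (Fin (n + 1) × Fin (l + 1)) (Fin (n + 1) × Fin (l + 1)) ℂ →ₗ[ℂ] Alg n where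
  toFun M := Matrix.of fun s t => ∑ i, M (s, i) (t, i)
  map_add' M M' := by ext s t; simp [Finset.sum_add_distrib]
  map_smul' c M := by ext s t; simp [Finset.mul_sum]

theorem partialTrace_apply (M : Matrix (Fin (n + 1) × Fin (l + 1)) (Fin (n + 1) × Fin (l + 1)) ℂ)
    (s t : Fin (n + 1)) : partialTrace M s t = ∑ i, M (s, i) (t, i) := rfl

theorem trace_partialTrace
    (M : Matrix (Fin (n + 1) × Fin (l + 1)) (Fin (n + 1) × Fin (l + 1)) ℂ) :
    (partialTrace M).trace = M.trace := by
  simp [Matrix.trace, partialTrace_apply, Fintype.sum_prod_type]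

theorem leftX_mul_apply (M : Matrix (Fin (n + 1) × Fin (l + 1)) (Fin (n + 1) × Fin (l + 1)) ℂ)
    (a : Fin 3) (s t : Fin (n + 1)) (i j : Fin (l + 1)) :
    (leftX n l a * M) (s, i) (t, j) = ∑ s', spinX n a s s' * M (s', i) (t, j) := by
  simp [Matrix.mul_apply, leftX, Fintype.sum_prod_type, Matrix.one_apply]

theorem mul_leftX_apply (M : Matrix (Fin (n + 1) × Fin (l + 1)) (Fin (n + 1) × Fin (l + 1)) ℂ)
    (a : Fin 3) (s t : Fin (n + 1)) (i j : Fin (l + 1)) :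
    (M * leftX n l a) (s, i) (t, j) = ∑ s', M (s, i) (s', j) * spinX n a s' t := by
  simp [Matrix.mul_apply, leftX, Fintype.sum_prod_type, Matrix.one_apply]

theorem partialTrace_leftX_mul (a : Fin 3)
    (M : Matrix (Fin (n + 1) × Fin (l + 1)) (Fin (n + 1) × Fin (l + 1)) ℂ) :
    partialTrace (leftX n l a * M) = spinX n a * partialTrace M := by
  ext s t
  simp only [partialTrace_apply, leftX_mul_apply]
  simp only [Matrix.mul_apply, partialTrace_apply, Finset.mul_sum]
  rw [Finset.sum_comm]

theorem partialTrace_mul_leftX (a : Fin 3)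
    (M : Matrix (Fin (n + 1) × Fin (l + 1)) (Fin (n + 1) × Fin (l + 1)) ℂ) :
    partialTrace (M * leftX n l a) = partialTrace M * spinX n a := by
  ext s t
  simp only [partialTrace_apply, mul_leftX_apply]
  simp only [Matrix.mul_apply, partialTrace_apply, Finset.sum_mul]
  rw [Finset.sum_comm]

/-- The partial trace is cyclic in operators acting only on the traced factor. It therefore turns
covariance under `tensorX` into covariance under `spinX n`. -/
theorem partialTrace_rightX_mul (a : Fin 3)
    (M : Matrix (Fin (n + 1) × Fin (l + 1)) (Fin (n + 1) × Fin (l + 1)) ℂ) :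
    partialTrace (rightX n l a * M) = partialTrace (M * rightX n l a) := by
  ext s t
  simp only [partialTrace_apply, Matrix.mul_apply, rightX, Fintype.sum_prod_type,
    Matrix.kroneckerMap_apply, Matrix.one_apply]
  simp only [ite_mul, one_mul, zero_mul, mul_ite, mul_zero, Finset.sum_ite_irrel,
    Finset.sum_const_zero, Finset.sum_ite_eq, Finset.sum_ite_eq', Finset.mem_univ, if_true]
  rw [Finset.sum_comm]
  exact Finset.sum_congr rfl fun i _ => Finset.sum_congr rfl fun j _ => mul_comm _ _

theorem innerDer_blocks (a : Fin 3)
    (M : Matrix (Fin (n + 1) × Fin (l + 1)) (Fin (n + 1) × Fin (l + 1)) ℂ) (i j : Fin (l + 1)) :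
    innerDer (spinX n a) (blocks M i j) =
      blocks (leftX n l a * M - M * leftX n l a) i j := by
  ext s t
  simp only [blocks, Matrix.of_apply, Matrix.sub_apply, leftX_mul_apply, mul_leftX_apply]
  simp [innerDer, Matrix.mul_apply]

/-- Together with `innerDer_blocks`, this turns the index sums in `chernForm` into a partial trace
of products and commutators on the tensor product. -/
theorem sum_blocks_mul (A B C : Matrix (Fin (n + 1) × Fin (l + 1)) (Fin (n + 1) × Fin (l + 1)) ℂ) :
    ∑ i, ∑ j, ∑ k, blocks A i j * (blocks B j k * blocks C k i) = partialTrace (A * B * C) := by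
  have hmul : ∀ (M M' : Matrix (Fin (n + 1) × Fin (l + 1)) (Fin (n + 1) × Fin (l + 1)) ℂ) i j,
      ∑ k, blocks M i k * blocks M' k j = blocks (M * M') i j := by
    intro M M' i j
    ext s t
    simp only [Matrix.sum_apply, blocks, Matrix.mul_apply, Matrix.of_apply, Fintype.sum_prod_type]
    rw [Finset.sum_comm]
  simp_rw [← Finset.mul_sum, hmul, mul_assoc]
  ext s t
  simp [Matrix.sum_apply, blocks, partialTrace_apply]

end PartialTrace

/-! ### Two-forms on the fuzzy sphere -/

/-- The derivation `e_a = [X_a, ·]` as a vector field. -/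
def der (n : ℕ) (a : Fin 3) : der3 n :=
  ⟨innerDer (spinX n a), Submodule.subset_span ⟨a, rfl⟩⟩

theorem dZero_der (n : ℕ) (f : Alg n) (a : Fin 3) :
    dZero (der3 n) f (der n a) = innerDer (spinX n a) f := rfl

/-- The `e_a` span `der3 n`, so linearity in each argument suffices; currying reduces this to two
extensions of linear maps. -/
theorem twoForm_ext {n : ℕ} {η η' : TwoForm (der3 n)}
    (h : ∀ a b, η ![der n a, der n b] = η' ![der n a, der n b]) : η = η' := by
  have htop : Submodule.span ℂ (Set.range (der n)) = ⊤ := by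
    refine Eq.trans ?_ (Submodule.span_span_coe_preimage (R := ℂ)
      (s := Set.range fun a => innerDer (spinX n a)))
    congr 1
    ext x
    constructor
    · rintro ⟨a, rfl⟩; exact ⟨a, rfl⟩
    · rintro ⟨a, ha⟩; exact ⟨a, Subtype.ext ha⟩
  have h1 : ∀ a, (η.curryLeft (der n a)).curryLeft = (η'.curryLeft (der n a)).curryLeft := by
    intro a
    refine LinearMap.ext_on_range htop fun b => AlternatingMap.ext fun v => ?_
    rw [Subsingleton.elim v ![]]
    exact h a b
  have h2 : η.curryLeft = η'.curryLeft := by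
    refine LinearMap.ext_on_range htop fun a => AlternatingMap.ext fun v => ?_
    have := congrArg (fun L => L (v 0) ![]) (h1 a)
    simp only [AlternatingMap.curryLeft_apply_apply] at this ⊢
    rwa [show Matrix.vecCons (v 0) ![] = v from funext fun i => by fin_cases i; rfl] at this
  refine AlternatingMap.ext fun u => ?_
  have := congrArg (fun L => L (u 0) ![u 1]) h2
  simp only [AlternatingMap.curryLeft_apply_apply] at this
  rwa [show Matrix.vecCons (u 0) ![u 1] = u from funext fun i => by fin_cases i <;> rfl] at this

theorem twoForm_sum_apply {n : ℕ} {κ : Type} (s : Finset κ) (η : κ → TwoForm (der3 n))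
    (u : Fin 2 → der3 n) : (∑ i ∈ s, η i) u = ∑ i ∈ s, η i u :=
  map_sum (⟨⟨fun η : TwoForm (der3 n) => η u, rfl⟩, fun _ _ => rfl⟩ : TwoForm (der3 n) →+ Alg n) η s

theorem chernForm_apply (n : ℕ) {ι : Type} [Fintype ι] (p : Matrix ι ι (Alg n)) (a b : Fin 3) :
    chernForm (der3 n) p ![der n a, der n b] =
      (∑ i, ∑ j, ∑ k, p i j *
        (innerDer (spinX n a) (p j k) * innerDer (spinX n b) (p k i))) -
      ∑ i, ∑ j, ∑ k, p i j *
        (innerDer (spinX n b) (p j k) * innerDer (spinX n a) (p k i)) := by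
  simp only [← Finset.sum_sub_distrib, ← mul_sub, chernForm, twoForm_sum_apply,
    AlternatingMap.smul_apply, wedge_apply, smul_eq_mul, Matrix.cons_val_zero, Matrix.cons_val_one,
    dZero_der]

theorem chernForm_blocks {n l : ℕ}
    (M : Matrix (Fin (n + 1) × Fin (l + 1)) (Fin (n + 1) × Fin (l + 1)) ℂ) (a b : Fin 3) :
    chernForm (der3 n) (blocks M) ![der n a, der n b] =
      partialTrace (M * (leftX n l a * M - M * leftX n l a) *
        (leftX n l b * M - M * leftX n l b)) -
      partialTrace (M * (leftX n l b * M - M * leftX n l b) *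
        (leftX n l a * M - M * leftX n l a)) := by
  rw [chernForm_apply]
  simp only [innerDer_blocks, sum_blocks_mul]

/-! ### The Chern form of the projection -/

section ChernForm

variable {n l m : ℕ} {τ : Matrix (Fin (n + 1) × Fin (l + 1)) (Fin (m + 1)) ℂ}

theorem conjTranspose_mul_tensorX (hτ : ∀ a, tensorX n l a * τ = τ * spinX m a) (a : Fin 3) :
    τ.conjTranspose * tensorX n l a = spinX m a * τ.conjTranspose := by
  have := congrArg Matrix.conjTranspose (hτ a)
  rwa [Matrix.conjTranspose_mul, Matrix.conjTranspose_mul, tensorX_isHermitian,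
    spinX_isHermitian] at this

theorem tensorX_mul_projector (hτ : ∀ a, tensorX n l a * τ = τ * spinX m a) (a : Fin 3) :
    tensorX n l a * (τ * τ.conjTranspose) = τ * τ.conjTranspose * tensorX n l a := by
  rw [← Matrix.mul_assoc, hτ, Matrix.mul_assoc, Matrix.mul_assoc, conjTranspose_mul_tensorX hτ]

theorem sum_leftX_mul_self (n l : ℕ) : ∑ a, leftX n l a * leftX n l a =
    ((n : ℂ) / 2 * ((n : ℂ) / 2 + 1)) •
      (1 : Matrix (Fin (n + 1) × Fin (l + 1)) (Fin (n + 1) × Fin (l + 1)) ℂ) := by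
  have h := sum_spinX_mul_self n
  rw [Fin.sum_univ_three] at h ⊢
  simp only [leftX, ← Matrix.mul_kronecker_mul, mul_one, ← Matrix.add_kronecker, h,
    Matrix.smul_kronecker, Matrix.one_kronecker_one]

theorem sum_rightX_mul_self (n l : ℕ) : ∑ a, rightX n l a * rightX n l a =
    ((l : ℂ) / 2 * ((l : ℂ) / 2 + 1)) •
      (1 : Matrix (Fin (n + 1) × Fin (l + 1)) (Fin (n + 1) × Fin (l + 1)) ℂ) := by
  have h := sum_spinX_mul_self l
  rw [Fin.sum_univ_three] at h ⊢
  simp only [rightX, ← Matrix.mul_kronecker_mul, mul_one, ← Matrix.kronecker_add, h,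
    Matrix.kronecker_smul, Matrix.one_kronecker_one]

theorem sum_tensorX_mul_self_mul (hτ : ∀ a, tensorX n l a * τ = τ * spinX m a) :
    (∑ a, tensorX n l a * tensorX n l a) * τ = ((m : ℂ) / 2 * ((m : ℂ) / 2 + 1)) • τ := by
  simp_rw [Matrix.sum_mul, Matrix.mul_assoc, hτ, ← Matrix.mul_assoc, hτ, Matrix.mul_assoc]
  rw [← Matrix.mul_sum, sum_spinX_mul_self, Matrix.mul_smul, Matrix.mul_one]

/-- Polarization: as `R = J - L` and `L` commutes with `R`, `2 L·J = J² + L² - R²`, and all three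
Casimir operators are scalar on the component. -/
theorem two_smul_sum_leftX_mul (hτ : ∀ a, tensorX n l a * τ = τ * spinX m a) :
    (2 : ℂ) • (∑ a, leftX n l a * tensorX n l a) * τ =
      ((m : ℂ) / 2 * ((m : ℂ) / 2 + 1) + (n : ℂ) / 2 * ((n : ℂ) / 2 + 1) -
        (l : ℂ) / 2 * ((l : ℂ) / 2 + 1)) • τ := by
  have key : (2 : ℂ) • (∑ a, leftX n l a * tensorX n l a) =
      ∑ a, tensorX n l a * tensorX n l a + ∑ a, leftX n l a * leftX n l a -
        ∑ a, rightX n l a * rightX n l a := by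
    rw [Finset.smul_sum, ← Finset.sum_add_distrib, ← Finset.sum_sub_distrib]
    refine Finset.sum_congr rfl fun a _ => ?_
    have := leftX_mul_rightX n l a a
    simp only [tensorX_eq, mul_add, add_mul, this, two_smul]
    abel
  rw [key, Matrix.sub_mul, Matrix.add_mul, sum_tensorX_mul_self_mul hτ, sum_leftX_mul_self,
    sum_rightX_mul_self, Matrix.smul_mul, Matrix.smul_mul, Matrix.one_mul]
  module

theorem two_smul_sum_rightX_mul (hτ : ∀ a, tensorX n l a * τ = τ * spinX m a) :
    (2 : ℂ) • (∑ a, rightX n l a * tensorX n l a) * τ =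
      ((m : ℂ) / 2 * ((m : ℂ) / 2 + 1) + (l : ℂ) / 2 * ((l : ℂ) / 2 + 1) -
        (n : ℂ) / 2 * ((n : ℂ) / 2 + 1)) • τ := by
  have key : (2 : ℂ) • (∑ a, rightX n l a * tensorX n l a) =
      ∑ a, tensorX n l a * tensorX n l a + ∑ a, rightX n l a * rightX n l a -
        ∑ a, leftX n l a * leftX n l a := by
    rw [Finset.smul_sum, ← Finset.sum_add_distrib, ← Finset.sum_sub_distrib]
    refine Finset.sum_congr rfl fun a _ => ?_
    have := leftX_mul_rightX n l a a
    simp only [tensorX_eq, mul_add, add_mul, this, two_smul]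
    abel
  rw [key, Matrix.sub_mul, Matrix.add_mul, sum_tensorX_mul_self_mul hτ, sum_leftX_mul_self,
    sum_rightX_mul_self, Matrix.smul_mul, Matrix.smul_mul, Matrix.one_mul]
  module

/-- The compression of the second spin operator to an irreducible component is a multiple of the
generators. -/
theorem exists_compression_rightX (h1 : τ.conjTranspose * τ = 1)
    (hτ : ∀ a, tensorX n l a * τ = τ * spinX m a) :
    ∃ κ : ℂ, (∀ a, τ.conjTranspose * rightX n l a * τ = κ • spinX m a) ∧
      2 * κ * ((m : ℂ) / 2 * ((m : ℂ) / 2 + 1)) =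
        (m : ℂ) / 2 * ((m : ℂ) / 2 + 1) + (l : ℂ) / 2 * ((l : ℂ) / 2 + 1) -
          (n : ℂ) / 2 * ((n : ℂ) / 2 + 1) := by
  have hs := conjTranspose_mul_tensorX hτ
  have hv : IsVectorOperator (spinX m) fun a => τ.conjTranspose * rightX n l a * τ := by
    intro a b
    have h := isVectorOperator_tensorX_rightX n l a b
    have e : spinX m a * (τ.conjTranspose * rightX n l b * τ) -
        τ.conjTranspose * rightX n l b * τ * spinX m a =
        τ.conjTranspose * (tensorX n l a * rightX n l b - rightX n l b * tensorX n l a) * τ := by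
      rw [← Matrix.mul_assoc, ← Matrix.mul_assoc, ← hs, Matrix.mul_assoc _ τ, ← hτ,
        Matrix.mul_sub, Matrix.sub_mul]
      simp only [Matrix.mul_assoc]
    simp only [e, h, Matrix.mul_sum, Matrix.sum_mul, Matrix.mul_smul, Matrix.smul_mul]
  obtain ⟨κ, hκ⟩ := hv.exists_eq_smul
  refine ⟨κ, fun a => congrFun hκ a, ?_⟩
  -- Contracting with the generators turns the compression of `R` into that of `R·J`, whose value on
  -- the component is known; this fixes `κ`.
  have e : (2 : ℂ) • ∑ a, (τ.conjTranspose * rightX n l a * τ) * spinX m a =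
      τ.conjTranspose * ((2 : ℂ) • (∑ a, rightX n l a * tensorX n l a) * τ) := by
    rw [Matrix.smul_mul, Matrix.mul_smul, Matrix.sum_mul, Matrix.mul_sum]
    congr 1
    refine Finset.sum_congr rfl fun a _ => ?_
    simp only [Matrix.mul_assoc, hτ]
  have e2 : ∀ a, τ.conjTranspose * rightX n l a * τ = κ • spinX m a := fun a => congrFun hκ a
  simp only [e2] at e
  rw [two_smul_sum_rightX_mul hτ, Matrix.mul_smul, h1] at e
  simp only [Matrix.smul_mul] at e
  rw [← Finset.smul_sum, sum_spinX_mul_self, smul_smul, smul_smul] at e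
  have := congrFun (congrFun e 0) 0
  simpa [mul_assoc] using this

/-- `J_b P` is a vector operator for `J`, and its commutators with `R` disappear under the partial
trace, so Wigner–Eckart applies on `[n/2]`. The constant comes from taking the full trace of `2 L·J
P`, where `Tr P = m + 1`. -/
theorem exists_partialTrace_tensorX_mul (h1 : τ.conjTranspose * τ = 1)
    (hτ : ∀ a, tensorX n l a * τ = τ * spinX m a) :
    ∃ ρ : ℂ, (∀ a, partialTrace (tensorX n l a * (τ * τ.conjTranspose)) = ρ • spinX n a) ∧
      2 * ρ * ((n : ℂ) / 2 * ((n : ℂ) / 2 + 1)) * ((n : ℂ) + 1) =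
        ((m : ℂ) / 2 * ((m : ℂ) / 2 + 1) + (n : ℂ) / 2 * ((n : ℂ) / 2 + 1) -
          (l : ℂ) / 2 * ((l : ℂ) / 2 + 1)) * ((m : ℂ) + 1) := by
  have hcomm := tensorX_mul_projector hτ
  have hv : IsVectorOperator (spinX n)
      fun a => partialTrace (tensorX n l a * (τ * τ.conjTranspose)) := by
    intro a b
    have h := isVectorOperator_tensorX n l a b
    simp only
    rw [← partialTrace_leftX_mul, ← partialTrace_mul_leftX, ← map_sub]
    have e : leftX n l a * (tensorX n l b * (τ * τ.conjTranspose)) -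
        tensorX n l b * (τ * τ.conjTranspose) * leftX n l a =
        (tensorX n l a * tensorX n l b - tensorX n l b * tensorX n l a) * (τ * τ.conjTranspose) -
        (rightX n l a * (tensorX n l b * (τ * τ.conjTranspose)) -
          tensorX n l b * (τ * τ.conjTranspose) * rightX n l a) := by
      have : leftX n l a = tensorX n l a - rightX n l a := by rw [tensorX_eq, add_sub_cancel_right]
      rw [this, sub_mul, sub_mul, mul_sub, mul_assoc (tensorX n l b) (τ * τ.conjTranspose)
        (tensorX n l a), ← hcomm a]
      simp only [mul_assoc]
      abel
    rw [e, map_sub, map_sub, partialTrace_rightX_mul, sub_self, sub_zero, h, Finset.sum_mul,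
      map_sum]
    simp only [smul_mul_assoc, map_smul]
  obtain ⟨ρ, hρ⟩ := hv.exists_eq_smul
  have hρ' : ∀ a, partialTrace (tensorX n l a * (τ * τ.conjTranspose)) = ρ • spinX n a :=
    fun a => congrFun hρ a
  refine ⟨ρ, hρ', ?_⟩
  have e : partialTrace ((2 : ℂ) • (∑ a, leftX n l a * tensorX n l a) * τ * τ.conjTranspose) =
      (2 : ℂ) • ∑ a, spinX n a * partialTrace (tensorX n l a * (τ * τ.conjTranspose)) := by
    simp only [← partialTrace_leftX_mul, ← map_sum, ← map_smul]
    rw [Matrix.smul_mul, Matrix.smul_mul, Matrix.mul_assoc, Finset.sum_mul]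
    simp only [mul_assoc]
  simp only [hρ', mul_smul_comm] at e
  rw [two_smul_sum_leftX_mul hτ, ← Finset.smul_sum, sum_spinX_mul_self, Matrix.smul_mul] at e
  have t := congrArg Matrix.trace e
  rw [trace_partialTrace, Matrix.trace_smul, Matrix.trace_mul_comm, h1] at t
  simp only [Matrix.trace_smul, Matrix.trace_one, Fintype.card_fin, smul_eq_mul] at t
  push_cast at t
  rw [t]
  ring

theorem chernForm_projector_apply (h1 : τ.conjTranspose * τ = 1)
    (hτ : ∀ a, tensorX n l a * τ = τ * spinX m a) {κ ρ : ℂ}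
    (hκ : ∀ a, τ.conjTranspose * rightX n l a * τ = κ • spinX m a)
    (hρ : ∀ a, partialTrace (tensorX n l a * (τ * τ.conjTranspose)) = ρ • spinX n a)
    (a b : Fin 3) :
    chernForm (der3 n) (blocks (τ * τ.conjTranspose)) ![der n a, der n b] =
      ((κ ^ 2 - κ) * ρ) • ∑ c, (Complex.I * eps a b c) • spinX n c := by
  have hcomm := tensorX_mul_projector hτ
  set P := τ * τ.conjTranspose with hP
  have hPP : P * P = P := by
    rw [hP, Matrix.mul_assoc, ← Matrix.mul_assoc _ τ, h1, Matrix.one_mul]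
  -- The derivative of `P` is moved to the second factor, because `L + R` commutes with `P`.
  have hL : ∀ a, leftX n l a * P - P * leftX n l a = P * rightX n l a - rightX n l a * P := by
    intro a
    have : leftX n l a = tensorX n l a - rightX n l a := by rw [tensorX_eq, add_sub_cancel_right]
    rw [this, sub_mul, mul_sub, hcomm]
    abel
  have hprod : ∀ a b, P * (P * rightX n l a - rightX n l a * P) *
      (P * rightX n l b - rightX n l b * P) =
      P * rightX n l a * P * (P * rightX n l b * P) - P * (rightX n l a * rightX n l b) * P := by
    intro a b
    generalize rightX n l a = R
    generalize rightX n l b = S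
    have hP3 : ∀ Z, P * (P * Z) = P * Z := fun Z => by rw [← mul_assoc, hPP]
    simp only [mul_sub, sub_mul, mul_assoc, hP3]
    abel
  have hJ : ∀ c, τ * spinX m c * τ.conjTranspose = tensorX n l c * P := by
    intro c
    rw [← hτ, hP, Matrix.mul_assoc]
  have hPRP : ∀ c, P * rightX n l c * P = κ • (τ * spinX m c * τ.conjTranspose) := by
    intro c
    calc _ = τ * (τ.conjTranspose * rightX n l c * τ) * τ.conjTranspose := by
          simp only [hP, Matrix.mul_assoc]
      _ = _ := by rw [hκ, Matrix.mul_smul, Matrix.smul_mul]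
  have hXX : ∀ a b, τ * spinX m a * τ.conjTranspose * (τ * spinX m b * τ.conjTranspose) =
      τ * (spinX m a * spinX m b) * τ.conjTranspose := by
    intro a b
    calc _ = τ * spinX m a * (τ.conjTranspose * τ) * (spinX m b * τ.conjTranspose) := by
          simp only [Matrix.mul_assoc]
      _ = _ := by rw [h1]; simp only [Matrix.mul_assoc, Matrix.one_mul]
  rw [chernForm_blocks]
  simp only [hL, hprod, hPRP, smul_mul_smul_comm, hXX]
  rw [← map_sub]
  -- Antisymmetrization leaves two commutators. The first yields `κ²`, and the second, being linear
  -- in `R` between two factors `P`, yields `κ`.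
  have e : (κ * κ) • (τ * (spinX m a * spinX m b) * τ.conjTranspose) -
      P * (rightX n l a * rightX n l b) * P -
      ((κ * κ) • (τ * (spinX m b * spinX m a) * τ.conjTranspose) -
        P * (rightX n l b * rightX n l a) * P) =
      (κ * κ) • (τ * (spinX m a * spinX m b - spinX m b * spinX m a) * τ.conjTranspose) -
        P * (rightX n l a * rightX n l b - rightX n l b * rightX n l a) * P := by
    rw [Matrix.mul_sub, Matrix.sub_mul, mul_sub, sub_mul]
    module
  rw [e, isVectorOperator_spinX, isVectorOperator_rightX]
  simp only [Matrix.mul_sum, Matrix.sum_mul, Matrix.mul_smul, Matrix.smul_mul, hPRP, hJ, map_sub,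
    map_sum, map_smul, hρ, Finset.smul_sum, ← Finset.sum_sub_distrib]
  refine Finset.sum_congr rfl fun c _ => ?_
  module

end ChernForm

/-! ### The volume form and the fuzzy integral -/

theorem sum_eps_smul {M : Type} [AddCommGroup M] [Module ℂ M] (f : Fin 3 → Fin 3 → Fin 3 → M) :
    ∑ a, ∑ b, ∑ c, eps a b c • f a b c =
      f 0 1 2 + f 1 2 0 + f 2 0 1 - f 0 2 1 - f 2 1 0 - f 1 0 2 := by
  simp only [Fin.sum_univ_three, eps]
  norm_num
  abel

/-- Moving every `z` to the right gives twice the Casimir operator times `z`; the commutator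
corrections add up to `i [x, y] = -z`. -/
theorem triple_product_identity {A : Type} [Ring A] [Algebra ℂ A] {x y z : A} {c : ℂ}
    (hxy : x * y - y * x = Complex.I • z) (hyz : y * z - z * y = Complex.I • x)
    (hzx : z * x - x * z = Complex.I • y) (hc : (x * x + y * y + z * z) * z = c • z) :
    z * (z * z) + z * (z * z) + x * (z * x) + x * (x * z) + y * (y * z) + y * (z * y) =
      (2 * c - 1) • z := by
  have e1 : x * (z * x) = x * (x * z) + Complex.I • (x * y) := by
    rw [sub_eq_iff_eq_add.1 hzx, mul_add, mul_smul_comm, add_comm]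
  have e2 : y * (z * y) = y * (y * z) - Complex.I • (y * x) := by
    rw [← mul_smul_comm, ← hyz, mul_sub]
    abel
  have e3 : Complex.I • (x * y) - Complex.I • (y * x) = -z := by
    rw [← smul_sub, hxy, smul_smul, Complex.I_mul_I, neg_one_smul]
  simp only [add_mul, mul_assoc] at hc
  calc _ = (2 : ℂ) • (x * (x * z) + y * (y * z) + z * (z * z)) +
        (Complex.I • (x * y) - Complex.I • (y * x)) := by
          rw [e1, e2]; module
    _ = _ := by rw [hc, e3]; module

/-- The normalization factor `(N (N + 1))^{-1/2}`. -/
def normFactor (n : ℕ) : ℂ :=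
  ((1 / Real.sqrt ((n : ℝ) / 2 * ((n : ℝ) / 2 + 1)) : ℝ) : ℂ)

theorem innerDer_apply {A : Type} [Ring A] [Algebra ℂ A] (x y : A) :
    innerDer x y = x * y - y * x := rfl

/-- Each inner derivative is again a generator up to a factor, so for `a ≠ b` the sum consists of
the six cubic terms of `triple_product_identity`, in one of its three cyclic versions up to sign. -/
theorem sum_eps_triple (n : ℕ) (a b : Fin 3) :
    ∑ x, ∑ y, ∑ z, eps x y z • (spinX n x *
      (innerDer (spinX n a) (spinX n y) * innerDer (spinX n b) (spinX n z) -
        innerDer (spinX n b) (spinX n y) * innerDer (spinX n a) (spinX n z))) =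
      (1 - 2 * ((n : ℂ) / 2 * ((n : ℂ) / 2 + 1))) • ∑ c, eps a b c • spinX n c := by
  have h := isVectorOperator_spinX n
  have hC := sum_spinX_mul_self n
  rw [Fin.sum_univ_three] at hC
  rw [sum_eps_smul]
  simp only [innerDer_apply]
  generalize (n : ℂ) / 2 * ((n : ℂ) / 2 + 1) = c at *
  have c01 := h.apply₀₁
  have c10 := h.apply₁₀
  have c12 := h.apply₁₂
  have c21 := h.apply₂₁
  have c20 := h.apply₂₀
  have c02 := h.apply₀₂
  have t2 := triple_product_identity (c := c) c01 c12 c20 (by rw [hC]; simp)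
  have t0 := triple_product_identity (c := c) c12 c20 c01
    (by rw [show spinX n 1 * spinX n 1 + spinX n 2 * spinX n 2 + spinX n 0 * spinX n 0 =
      c • (1 : Alg n) by rw [← hC]; abel]; simp)
  have t1 := triple_product_identity (c := c) c20 c01 c12
    (by rw [show spinX n 2 * spinX n 2 + spinX n 0 * spinX n 0 + spinX n 1 * spinX n 1 =
      c • (1 : Alg n) by rw [← hC]; abel]; simp)
  have hI : Complex.I * Complex.I = -1 := Complex.I_mul_I
  have key01 := (neg_smul (2 * c - 1) (spinX n 2)).trans (congrArg Neg.neg t2.symm)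
  have key12 := (neg_smul (2 * c - 1) (spinX n 0)).trans (congrArg Neg.neg t0.symm)
  have key20 := (neg_smul (2 * c - 1) (spinX n 1)).trans (congrArg Neg.neg t1.symm)
  rw [neg_sub] at key01 key12 key20
  fin_cases a <;> fin_cases b <;>
    simp only [Fin.zero_eta, Fin.mk_one, Fin.reduceFinMk, sub_self, c01, c10, c12, c21, c20, c02,
      zero_mul, mul_zero, sub_zero, zero_sub, add_zero, smul_mul_smul_comm, neg_mul,
      mul_neg, neg_neg, hI, neg_smul, one_smul, mul_sub, Fin.sum_univ_three, eps,
      Fin.coe_ofNat_eq_mod, smul_add, smul_smul] <;>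
    norm_num <;>
    first
    | rw [key01]; abel
    | rw [key12]; abel
    | rw [key20]; abel
    | rw [← t2]; abel
    | rw [← t1]; abel
    | rw [← t0]; abel

theorem epsYdYdY_apply (n : ℕ) (a b : Fin 3) :
    epsYdYdY n ![der n a, der n b] =
      (normFactor n ^ 3 * (1 - 2 * ((n : ℂ) / 2 * ((n : ℂ) / 2 + 1)))) •
        ∑ c, eps a b c • spinX n c := by
  rw [mul_smul, ← sum_eps_triple, epsYdYdY]
  simp only [twoForm_sum_apply, AlternatingMap.smul_apply, wedge_apply, smul_eq_mul,
    Matrix.cons_val_zero, Matrix.cons_val_one, dZero_der, Finset.smul_sum]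
  refine Finset.sum_congr rfl fun x _ => Finset.sum_congr rfl fun y _ =>
    Finset.sum_congr rfl fun z _ => ?_
  have hY : ∀ a, coordY n a = normFactor n • spinX n a := fun _ => rfl
  simp only [hY, map_smul, smul_mul_smul_comm, ← smul_sub, smul_smul]
  congr 1
  ring

theorem casimir_ne_zero {n : ℕ} (hn : 0 < n) : (n : ℂ) / 2 * ((n : ℂ) / 2 + 1) ≠ 0 := by
  have : (n : ℝ) / 2 * ((n : ℝ) / 2 + 1) ≠ 0 := by positivity
  have := Complex.ofReal_ne_zero.2 this
  push_cast at this
  exact this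

/-- Spin `1/2` is the extreme case. The bound exceeds `1/2`, which keeps the denominator `1/2 -
N(N+1)` of the charge away from zero. -/
theorem casimir_lower {n : ℕ} (hn : 0 < n) : 3 / 4 ≤ (n : ℝ) / 2 * ((n : ℝ) / 2 + 1) := by
  have : (1 : ℝ) ≤ n := by exact_mod_cast hn
  nlinarith

theorem normFactor_ne_zero {n : ℕ} (hn : 0 < n) : normFactor n ≠ 0 := by
  have := casimir_lower hn
  have : 0 < Real.sqrt ((n : ℝ) / 2 * ((n : ℝ) / 2 + 1)) := Real.sqrt_pos.2 (by linarith)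
  unfold normFactor
  rw [Complex.ofReal_ne_zero]
  positivity

theorem one_sub_casimir_ne_zero {n : ℕ} (hn : 0 < n) :
    (1 - 2 * ((n : ℂ) / 2 * ((n : ℂ) / 2 + 1))) ≠ 0 := by
  have := casimir_lower hn
  have : (1 - 2 * ((n : ℝ) / 2 * ((n : ℝ) / 2 + 1))) ≠ 0 := by linarith
  have := Complex.ofReal_ne_zero.2 this
  push_cast at this
  exact this

/-- The values of `φ ω` on pairs of the `e_a` determine every `φ X_c`, hence `φ ∑ X_c²`, which is a
nonzero multiple of `φ`. -/
theorem smul_volForm_injective {n : ℕ} (hn : 0 < n) {φ ψ : Alg n}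
    (h : φ • volForm n = ψ • volForm n) : φ = ψ := by
  set t : ℂ := (1 / (8 * Real.pi) : ℂ) *
    (normFactor n ^ 3 * (1 - 2 * ((n : ℂ) / 2 * ((n : ℂ) / 2 + 1)))) with ht
  have ht0 : t ≠ 0 := by
    refine mul_ne_zero ?_ (mul_ne_zero (pow_ne_zero _ (normFactor_ne_zero hn))
      (one_sub_casimir_ne_zero hn))
    have : (Real.pi : ℂ) ≠ 0 := by exact_mod_cast Real.pi_ne_zero
    simp [this]
  have hab : ∀ a b, φ * (∑ c, eps a b c • spinX n c) = ψ * ∑ c, eps a b c • spinX n c := by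
    intro a b
    have e := congrArg (fun η : TwoForm (der3 n) => η ![der n a, der n b]) h
    simp only [AlternatingMap.smul_apply, smul_eq_mul, volForm, epsYdYdY_apply, smul_smul,
      mul_smul_comm, ← ht] at e
    exact smul_right_injective _ ht0 e
  have hc : ∀ c, φ * spinX n c = ψ * spinX n c := by
    have h01 := hab 0 1
    have h12 := hab 1 2
    have h20 := hab 2 0
    simp [Fin.sum_univ_three, eps] at h01 h12 h20
    norm_num at h01 h12 h20
    intro c
    fin_cases c
    · exact h12
    · exact h20
    · exact h01
  have e : φ * ∑ c, spinX n c * spinX n c = ψ * ∑ c, spinX n c * spinX n c := by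
    simp only [Finset.mul_sum, ← mul_assoc, hc]
  rw [sum_spinX_mul_self, mul_smul_comm, mul_smul_comm, mul_one, mul_one] at e
  exact smul_right_injective _ (casimir_ne_zero hn) e

theorem fuzzyIntegral_smul_volForm {n : ℕ} (hn : 0 < n) (φ : Alg n) :
    fuzzyIntegral n (φ • volForm n) = φ.trace / ((n : ℂ) + 1) := by
  have h : ∃ ψ : Alg n, φ • volForm n = ψ • volForm n := ⟨φ, rfl⟩
  rw [fuzzyIntegral, dif_pos h, ← smul_volForm_injective hn h.choose_spec]

theorem fuzzyIntegral_smul_epsYdYdY {n : ℕ} (hn : 0 < n) (c : ℂ) :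
    fuzzyIntegral n (c • epsYdYdY n) = 8 * Real.pi * c := by
  have hpi : (Real.pi : ℂ) ≠ 0 := by exact_mod_cast Real.pi_ne_zero
  have e : c • epsYdYdY n = ((8 * Real.pi * c) • (1 : Alg n)) • volForm n := by
    refine twoForm_ext fun a b => ?_
    simp only [volForm, AlternatingMap.smul_apply, smul_eq_mul, smul_mul_assoc, one_mul, smul_smul]
    congr 1
    field_simp
  rw [e, fuzzyIntegral_smul_volForm hn, Matrix.trace_smul, Matrix.trace_one, Fintype.card_fin,
    smul_eq_mul]
  have : (n : ℂ) + 1 ≠ 0 := by exact_mod_cast n.succ_ne_zero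
  push_cast
  field_simp

/-! ### The Chern numbers -/

/-- The power `3/2` in the charge undoes the cubic normalization of the `Y_a`, and its denominator
is half the factor `1 - 2N(N+1)` from `sum_eps_triple`. The coefficient `f` is thus what remains on
pairs of derivations. -/
theorem charge_eq {n : ℕ} (hn : 0 < n) (f : ℂ) :
    Complex.I * charge (n / 2) f / 4 * (normFactor n ^ 3 *
      (1 - 2 * ((n : ℂ) / 2 * ((n : ℂ) / 2 + 1)))) = 2 * f := by
  have h0 := casimir_lower hn
  have h1 := one_sub_casimir_ne_zero hn
  unfold charge normFactor
  have e : ((n : ℂ) / 2 * ((n : ℂ) / 2 + 1)) = (((n : ℝ) / 2 * ((n : ℝ) / 2 + 1) : ℝ) : ℂ) := by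
    push_cast; rfl
  rw [e] at h1 ⊢
  generalize ((n : ℝ) / 2 * ((n : ℝ) / 2 + 1)) = C at *
  have hC : 0 < C := by linarith
  have hrp : C ^ (3 / 2 : ℝ) = Real.sqrt C ^ 3 := by
    rw [Real.sqrt_eq_rpow, ← Real.rpow_natCast, ← Real.rpow_mul hC.le]
    norm_num
  rw [hrp]
  have hs : (Real.sqrt C : ℂ) ≠ 0 := by exact_mod_cast (Real.sqrt_pos.2 hC).ne'
  have h2 : (1 / 2 - C : ℂ) ≠ 0 := by
    intro h; apply h1; linear_combination 2 * h
  push_cast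
  have hI := Complex.I_ne_zero
  field_simp

/-- The properties of the component `[m / 2]` of `[n / 2] ⊗ [l / 2]`. -/
theorem spinComponent_spec (n l m r : ℕ) (h : m + 2 * r = n + l) (hr : r ≤ n) (hl : r ≤ l)
    (hn : 0 < n) : (∃! W, IsSpinSubrep n l m W) ∧ ∃ κ ρ : ℂ,
      2 * κ * ((m : ℂ) / 2 * ((m : ℂ) / 2 + 1)) =
        (m : ℂ) / 2 * ((m : ℂ) / 2 + 1) + (l : ℂ) / 2 * ((l : ℂ) / 2 + 1) -
          (n : ℂ) / 2 * ((n : ℂ) / 2 + 1) ∧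
      2 * ρ * ((n : ℂ) / 2 * ((n : ℂ) / 2 + 1)) * ((n : ℂ) + 1) =
        ((m : ℂ) / 2 * ((m : ℂ) / 2 + 1) + (n : ℂ) / 2 * ((n : ℂ) / 2 + 1) -
          (l : ℂ) / 2 * ((l : ℂ) / 2 + 1)) * ((m : ℂ) + 1) ∧
      ∀ f : ℂ, (κ ^ 2 - κ) * ρ * Complex.I = 2 * f →
        fuzzyChernForm n l m = (Complex.I * charge (n / 2) f / 4) • epsYdYdY n := by
  obtain ⟨τ, h1, hτ, hu⟩ := exists_isometric_intertwining n l m r h hr hl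
  have hiff := isSpinSubrep_iff h1 hτ hu
  refine ⟨⟨_, (hiff _).2 rfl, fun W hW => (hiff W).1 hW⟩, ?_⟩
  obtain ⟨κ, hκ, hκ'⟩ := exists_compression_rightX h1 hτ
  obtain ⟨ρ, hρ, hρ'⟩ := exists_partialTrace_tensorX_mul h1 hτ
  refine ⟨κ, ρ, hκ', hρ', fun f hf => ?_⟩
  have hW : spinComponent n l m = LinearMap.range τ.toEuclideanLin := by
    rw [spinComponent, show {W | IsSpinSubrep n l m W} = {LinearMap.range τ.toEuclideanLin} from
      Set.ext hiff, sSup_singleton]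
  refine twoForm_ext fun a b => ?_
  rw [fuzzyChernForm, fuzzyProjector_eq h1 hW, chernForm_projector_apply h1 hτ hκ hρ,
    AlternatingMap.smul_apply, epsYdYdY_apply, smul_smul, charge_eq hn, ← hf]
  simp only [Finset.smul_sum, smul_smul]
  refine Finset.sum_congr rfl fun c _ => ?_
  congr 1
  ring

theorem fuzzyChern_eq {n l m : ℕ} (hn : 0 < n) {q : ℂ}
    (h : fuzzyChernForm n l m = (Complex.I * q / 4) • epsYdYdY n) : fuzzyChern n l m = -q := by
  have hpi : (Real.pi : ℂ) ≠ 0 := by exact_mod_cast Real.pi_ne_zero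
  rw [fuzzyChern, h, fuzzyIntegral_smul_epsYdYdY hn]
  field_simp
  rw [Complex.I_sq]
  ring

theorem fuzzyChern_plus (n l : ℕ) (hn : 0 < n) :
    (∃! W, IsSpinSubrep n l (n + l) W) ∧
      fuzzyChernForm n l (n + l) =
        (Complex.I * charge (n / 2) (fPlus (n / 2) (l / 2)) / 4) • epsYdYdY n ∧
      fuzzyChern n l (n + l) = -charge (n / 2) (fPlus (n / 2) (l / 2)) := by
  obtain ⟨hW, κ, ρ, hκ, hρ, hF⟩ := spinComponent_spec n l (n + l) 0 (by omega) (by omega)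
    (by omega) hn
  have hf := hF (fPlus (n / 2) (l / 2)) ?_
  · exact ⟨hW, hf, fuzzyChern_eq hn hf⟩
  have n0 : (n : ℂ) ≠ 0 := by exact_mod_cast hn.ne'
  have n1 : (n : ℂ) + 1 ≠ 0 := by exact_mod_cast (by omega : n + 1 ≠ 0)
  have n2 : (n : ℂ) + 2 ≠ 0 := by exact_mod_cast (by omega : n + 2 ≠ 0)
  have s0 : (n : ℂ) + l ≠ 0 := by exact_mod_cast (by omega : n + l ≠ 0)
  have s2 : (n : ℂ) + l + 2 ≠ 0 := by exact_mod_cast (by omega : n + l + 2 ≠ 0)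
  push_cast at hκ hρ
  -- The combination of Casimirs in `hκ` is `2l(n+l+2)/4`, so the factor `n + l + 2` cancels; in
  -- `hρ` it is `2n(n+l+2)/4`, so `n` cancels.
  have eκ : κ = l / (n + l) := by
    rw [eq_div_iff s0]
    apply mul_right_cancel₀ s2
    linear_combination 2 * hκ
  have eρ : ρ = (n + l + 2) * (n + l + 1) / ((n + 2) * (n + 1)) := by
    rw [eq_div_iff (mul_ne_zero n2 n1)]
    apply mul_right_cancel₀ n0
    linear_combination 2 * hρ
  rw [eκ, eρ, fPlus]
  push_cast
  rw [show (n : ℂ) / 2 + l / 2 = (n + l) / 2 by ring, show 2 * ((n : ℂ) / 2) + 1 = n + 1 by ring,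
    show (n : ℂ) / 2 + 1 = (n + 2) / 2 by ring]
  field_simp
  ring

theorem fuzzyChern_minus (n l : ℕ) (hln : l < n) :
    (∃! W, IsSpinSubrep n l (n - l) W) ∧
      fuzzyChernForm n l (n - l) =
        (Complex.I * charge (n / 2) (fMinus (n / 2) (l / 2)) / 4) • epsYdYdY n ∧
      fuzzyChern n l (n - l) = -charge (n / 2) (fMinus (n / 2) (l / 2)) := by
  have hn : 0 < n := by omega
  -- Naming the difference removes truncated subtraction. Here `k` is twice the spin of the
  -- component.
  obtain ⟨k, rfl⟩ : ∃ k, n = k + l := ⟨n - l, by omega⟩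
  have hk : 0 < k := by omega
  rw [show k + l - l = k by omega]
  obtain ⟨hW, κ, ρ, hκ, hρ, hF⟩ := spinComponent_spec (k + l) l k l (by omega) (by omega)
    (by omega) hn
  have hf := hF (fMinus ((k + l : ℕ) / 2) (l / 2)) ?_
  · exact ⟨hW, hf, fuzzyChern_eq hn hf⟩
  have k0 : (k : ℂ) ≠ 0 := by exact_mod_cast hk.ne'
  have k2 : (k : ℂ) + 2 ≠ 0 := by exact_mod_cast (by omega : k + 2 ≠ 0)
  have s0 : (k : ℂ) + l ≠ 0 := by exact_mod_cast (by omega : k + l ≠ 0)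
  have s1 : (k : ℂ) + l + 1 ≠ 0 := by exact_mod_cast (by omega : k + l + 1 ≠ 0)
  have s2 : (k : ℂ) + l + 2 ≠ 0 := by exact_mod_cast (by omega : k + l + 2 ≠ 0)
  push_cast at hκ hρ
  -- The Casimir combination is `-2kl/4`; cancelling `k` is where `l < n` is needed. In `hρ` it is
  -- `2k(k+l+2)/4`.
  have eκ : κ = -l / (k + 2) := by
    rw [eq_div_iff k2]
    apply mul_right_cancel₀ k0
    linear_combination 2 * hκ
  have eρ : ρ = k * (k + 1) / ((k + l) * (k + l + 1)) := by
    rw [eq_div_iff (mul_ne_zero s0 s1)]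
    apply mul_right_cancel₀ s2
    linear_combination 2 * hρ
  rw [eκ, eρ, fMinus]
  push_cast
  rw [show ((k : ℂ) + l) / 2 - l / 2 = k / 2 by ring,
    show 2 * (((k : ℂ) + l) / 2) + 1 = k + l + 1 by ring,
    show ((k : ℂ) + l) / 2 + 1 = (k + l + 2) / 2 by ring,
    show (k : ℂ) / 2 + 1 = (k + 2) / 2 by ring]
  field_simp
  ring

/-! ### Irrationality of the Chern numbers -/

theorem rpow_three_halves {C : ℝ} (hC : 0 ≤ C) : C ^ (3 / 2 : ℝ) = C * Real.sqrt C := by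
  have : Real.sqrt C ^ 3 = C * Real.sqrt C := by
    rw [pow_succ, Real.sq_sqrt hC]
  rw [← this, Real.sqrt_eq_rpow, ← Real.rpow_natCast, ← Real.rpow_mul hC]
  norm_num

theorem charge_ofReal {N : ℝ} (hN : 0 ≤ N) (g : ℝ) :
    charge N (Complex.I * g) =
      ((4 * (N * (N + 1) * Real.sqrt (N * (N + 1)) / (1 / 2 - N * (N + 1))) * g : ℝ) : ℂ) := by
  rw [charge, rpow_three_halves (by positivity)]
  have hI := Complex.I_ne_zero
  push_cast
  field_simp

/-- Four times the radicand is `n(n+2)`, and `n² < n(n+2) < (n+1)²`. -/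
theorem irrational_sqrt_casimir {n : ℕ} (hn : 0 < n) :
    Irrational (Real.sqrt ((n : ℝ) / 2 * ((n : ℝ) / 2 + 1))) := by
  have h : Irrational (Real.sqrt ((n * (n + 2) : ℕ) : ℝ)) := by
    rw [irrational_sqrt_natCast_iff]
    rintro ⟨k, hk⟩
    have h1 : n < k := by nlinarith
    have h2 : k < n + 1 := by nlinarith
    omega
  have e : (n : ℝ) / 2 * ((n : ℝ) / 2 + 1) = ((n * (n + 2) : ℕ) : ℝ) / 2 ^ 2 := by
    push_cast; ring
  rw [e, Real.sqrt_div' _ (by positivity), Real.sqrt_sq (by norm_num)]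
  exact_mod_cast h.div_natCast (m := 2) (by norm_num)

/-- For rational `g` the square root is the only irrational factor of the charge; the remaining one
is a nonzero rational. -/
theorem neg_charge_ne_intCast {n : ℕ} (hn : 0 < n) {g : ℚ} (hg : g ≠ 0) (z : ℤ) :
    -charge (n / 2) (Complex.I * ((g : ℝ) : ℂ)) ≠ z := by
  rw [charge_ofReal (by positivity)]
  intro h
  have hirr := irrational_sqrt_casimir hn
  have hC := casimir_lower hn
  have h' : -(4 * ((n : ℝ) / 2 * ((n : ℝ) / 2 + 1) *
      Real.sqrt ((n : ℝ) / 2 * ((n : ℝ) / 2 + 1)) /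
        (1 / 2 - (n : ℝ) / 2 * ((n : ℝ) / 2 + 1))) * g) = z := by exact_mod_cast h
  set c : ℚ := (n : ℚ) / 2 * ((n : ℚ) / 2 + 1) with hc
  have hcast : (n : ℝ) / 2 * ((n : ℝ) / 2 + 1) = (c : ℝ) := by rw [hc]; push_cast; ring
  rw [hcast] at h' hirr hC
  have hC' : (3 / 4 : ℚ) ≤ c := by
    rw [← Rat.cast_le (K := ℝ)]
    push_cast
    exact hC
  have hc1 : (1 / 2 - c : ℚ) ≠ 0 := by
    linarith
  have hc0 : c ≠ 0 := by
    linarith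
  have hq : (-(4 * c / (1 / 2 - c) * g) : ℚ) ≠ 0 := by
    refine neg_ne_zero.2 (mul_ne_zero (div_ne_zero (mul_ne_zero (by norm_num) hc0) hc1) hg)
  refine (hirr.ratCast_mul hq).ne_int z ?_
  rw [← h']
  push_cast
  ring

/-- The imaginary part of `fPlus`. -/
def gPlus {K : Type} [Field K] (N ν : K) : K :=
  -(N * ν * ((N + ν + 1) * (N + ν + 1 / 2)) / ((N + ν) ^ 2 * (2 * N + 1) * (N + 1)))

/-- The imaginary part of `fMinus`. -/
def gMinus {K : Type} [Field K] (N ν : K) : K :=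
  ν * (N + 1) * (N - ν) * (2 * N - 2 * ν + 1) / (2 * N * (2 * N + 1) * (N - ν + 1) ^ 2)

theorem fPlus_eq (N ν : ℝ) : fPlus N ν = Complex.I * ((gPlus N ν : ℝ) : ℂ) := by
  unfold fPlus gPlus
  push_cast
  ring

theorem fMinus_eq (N ν : ℝ) : fMinus N ν = Complex.I * ((gMinus N ν : ℝ) : ℂ) := by
  unfold fMinus gMinus
  push_cast
  ring

theorem fuzzyChern_plus_ne_intCast {n l : ℕ} (hn : 0 < n) (hl : 0 < l) (z : ℤ) :
    fuzzyChern n l (n + l) ≠ z := by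
  rw [(fuzzyChern_plus n l hn).2.2, fPlus_eq]
  have h := neg_charge_ne_intCast hn (g := gPlus (n / 2) (l / 2)) ?_ z
  -- Defining `gPlus` over any field lets the same expression be read over `ℚ` here and over `ℝ` in
  -- the limit.
  · rwa [show ((gPlus ((n : ℚ) / 2) (l / 2) : ℚ) : ℝ) = gPlus ((n : ℝ) / 2) (l / 2) by
      unfold gPlus; push_cast; rfl] at h
  · have h1 : (0 : ℚ) < n := by exact_mod_cast hn
    have h2 : (0 : ℚ) < l := by exact_mod_cast hl
    unfold gPlus
    refine neg_ne_zero.2 (ne_of_gt ?_)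
    positivity

theorem fuzzyChern_minus_ne_intCast {n l : ℕ} (hln : l < n) (hl : 0 < l) (z : ℤ) :
    fuzzyChern n l (n - l) ≠ z := by
  have hn : 0 < n := by omega
  rw [(fuzzyChern_minus n l hln).2.2, fMinus_eq]
  have h := neg_charge_ne_intCast hn (g := gMinus (n / 2) (l / 2)) ?_ z
  · rwa [show ((gMinus ((n : ℚ) / 2) (l / 2) : ℚ) : ℝ) = gMinus ((n : ℝ) / 2) (l / 2) by
      unfold gMinus; push_cast; rfl] at h
  · have h1 : (0 : ℚ) < n := by exact_mod_cast hn
    have h2 : (0 : ℚ) < l := by exact_mod_cast hl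
    have h3 : (l : ℚ) < n := by exact_mod_cast hln
    have h4 : (0 : ℚ) < n / 2 - l / 2 := by linarith
    have h5 : (0 : ℚ) < 2 * (n / 2) - 2 * (l / 2) + 1 := by linarith
    unfold gMinus
    refine ne_of_gt ?_
    positivity

/-! ### The commutative limit -/

/-- The factor of the charge that only depends on the spin `N`, up to the order `N`, as a function
of `t = 1 / N`. -/
def chargeFactor (t : ℝ) : ℝ := 4 * ((1 + t) * Real.sqrt (1 + t) / (t ^ 2 / 2 - (1 + t)))

theorem charge_factor_eq {N : ℝ} (hN : 1 / 2 ≤ N) :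
    4 * (N * (N + 1) * Real.sqrt (N * (N + 1)) / (1 / 2 - N * (N + 1))) =
      N * chargeFactor N⁻¹ := by
  have hN0 : 0 < N := by linarith
  have h1 : Real.sqrt (N * (N + 1)) = N * Real.sqrt (1 + N⁻¹) := by
    rw [show N * (N + 1) = N ^ 2 * (1 + N⁻¹) by field_simp, Real.sqrt_mul (by positivity),
      Real.sqrt_sq hN0.le]
  rw [h1, chargeFactor]
  have h2 : (1 / 2 - N * (N + 1)) ≠ 0 := by nlinarith
  have h3 : (N⁻¹ ^ 2 / 2 - (1 + N⁻¹)) ≠ 0 := by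
    intro h
    apply h2
    have : 1 / 2 - N * (N + 1) = N ^ 2 * (N⁻¹ ^ 2 / 2 - (1 + N⁻¹)) := by field_simp
    rw [this, h, mul_zero]
  have h4 : (1 / 2 - N * (N + 1)) = N ^ 2 * (N⁻¹ ^ 2 / 2 - (1 + N⁻¹)) := by field_simp
  have h5 : N * (N + 1) = N ^ 2 * (1 + N⁻¹) := by field_simp
  rw [h4, h5]
  generalize Real.sqrt (1 + N⁻¹) = s
  generalize N⁻¹ ^ 2 / 2 - (1 + N⁻¹) = d at *
  generalize 1 + N⁻¹ = e at *
  field_simp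

theorem tendsto_half_inv :
    Filter.Tendsto (fun n : ℕ => ((n : ℝ) / 2)⁻¹) Filter.atTop (nhds 0) :=
  Filter.Tendsto.inv_tendsto_atTop
    (Filter.Tendsto.atTop_div_const (by norm_num) tendsto_natCast_atTop_atTop)

/-- The charge is `chargeFactor (1/N)` times `N g(N)`. With `h` the continuous extension of the
latter in `t = 1/N`, the limit is `-chargeFactor 0 * h 0`, where `chargeFactor 0 = -4`. -/
theorem tendsto_neg_charge {g h : ℝ → ℝ} (hh : ContinuousAt h 0)
    (hg : ∀ᶠ n : ℕ in Filter.atTop, (n : ℝ) / 2 * g (n / 2) = h ((n : ℝ) / 2)⁻¹) :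
    Filter.Tendsto (fun n : ℕ => -charge ((n : ℝ) / 2) (Complex.I * (g (n / 2) : ℂ))) Filter.atTop
      (nhds ((4 * h 0 : ℝ) : ℂ)) := by
  have hcont : ContinuousAt (fun t => -(chargeFactor t * h t)) 0 := by
    unfold chargeFactor
    have h1 : ContinuousAt (fun t : ℝ => (1 + t) * Real.sqrt (1 + t) / (t ^ 2 / 2 - (1 + t))) 0 :=
      ContinuousAt.div (by fun_prop) (by fun_prop) (by norm_num)
    exact ((continuousAt_const.mul h1).mul hh).neg
  have hlim := (Complex.continuous_ofReal.tendsto _).comp (hcont.tendsto.comp tendsto_half_inv)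
  have h0 : -(chargeFactor 0 * h 0) = 4 * h 0 := by
    simp [chargeFactor]
  rw [h0] at hlim
  refine hlim.congr' ?_
  filter_upwards [hg, Filter.eventually_ge_atTop 1] with n hn hn1
  have hn1' : (1 : ℝ) ≤ n := by exact_mod_cast hn1
  rw [charge_ofReal (by positivity), charge_factor_eq (by linarith)]
  simp only [Function.comp_apply]
  rw [← hn]
  push_cast
  ring

theorem tendsto_fuzzyChern_plus (l : ℕ) :
    Filter.Tendsto (fun n : ℕ => fuzzyChern n l (n + l)) Filter.atTop (nhds (-(l : ℂ))) := by
  -- This is `N * gPlus N ν` with numerator and denominator divided by `N⁴` and `t = 1/N`; at `t =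
  -- 0` it equals `-l/4`.
  set h : ℝ → ℝ := fun t => -((l : ℝ) / 2 * ((1 + l / 2 * t + t) * (1 + l / 2 * t + t / 2)) /
    ((1 + l / 2 * t) ^ 2 * (2 + t) * (1 + t))) with hh
  have hc : ContinuousAt h 0 :=
    (ContinuousAt.div (by fun_prop) (by fun_prop) (by norm_num)).neg
  have key := tendsto_neg_charge (g := fun N => gPlus N (l / 2)) hc ?_
  · rw [show ((4 * h 0 : ℝ) : ℂ) = -(l : ℂ) by rw [hh]; push_cast; ring] at key
    refine key.congr' ?_
    filter_upwards [Filter.eventually_ge_atTop 1] with n hn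
    rw [(fuzzyChern_plus n l hn).2.2, fPlus_eq]
  · filter_upwards [Filter.eventually_ge_atTop 1] with n hn
    have hn' : (0 : ℝ) < (n : ℝ) / 2 := by
      have : (1 : ℝ) ≤ n := by exact_mod_cast hn
      linarith
    have hl' : (0 : ℝ) ≤ (l : ℝ) / 2 := by positivity
    simp only [hh, gPlus]
    generalize (n : ℝ) / 2 = N at *
    generalize (l : ℝ) / 2 = ν at *
    have h1 : N + ν ≠ 0 := by positivity
    have h2 : 2 * N + 1 ≠ 0 := by positivity
    have h3 : N + 1 ≠ 0 := by positivity
    field_simp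

theorem tendsto_fuzzyChern_minus (l : ℕ) :
    Filter.Tendsto (fun n : ℕ => fuzzyChern n l (n - l)) Filter.atTop (nhds (l : ℂ)) := by
  -- Again both sides of the fraction `N * gMinus N ν` are divided by `N⁴`; the value at `t = 0` is
  -- `l/4`.
  set h : ℝ → ℝ := fun t => (l : ℝ) / 2 * (1 + t) * (1 - l / 2 * t) * (2 - 2 * (l / 2) * t + t) /
    (2 * (2 + t) * (1 - l / 2 * t + t) ^ 2) with hh
  have hc : ContinuousAt h 0 :=
    ContinuousAt.div (by fun_prop) (by fun_prop) (by norm_num)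
  have key := tendsto_neg_charge (g := fun N => gMinus N (l / 2)) hc ?_
  · rw [show ((4 * h 0 : ℝ) : ℂ) = (l : ℂ) by rw [hh]; push_cast; ring] at key
    refine key.congr' ?_
    filter_upwards [Filter.eventually_gt_atTop l] with n hn
    rw [(fuzzyChern_minus n l hn).2.2, fMinus_eq]
  · filter_upwards [Filter.eventually_gt_atTop l] with n hn
    have hln : (l : ℝ) / 2 < (n : ℝ) / 2 := by
      have : (l : ℝ) < n := by exact_mod_cast hn
      linarith
    have hl' : (0 : ℝ) ≤ (l : ℝ) / 2 := by positivity
    simp only [hh, gMinus]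
    generalize (n : ℝ) / 2 = N at *
    generalize (l : ℝ) / 2 = ν at *
    have h0 : 0 < N := by linarith
    have h1 : N - ν + 1 ≠ 0 := by linarith
    have h2 : 2 * N + 1 ≠ 0 := by positivity
    field_simp

/-! ### The line bundles over the two-sphere -/

/-- A lift of a point of the two-sphere to the three-sphere. -/
def sphereLift (θ φ : ℝ) : ℂ × ℂ :=
  ((Real.cos (θ / 2) : ℂ), (Real.sin (θ / 2) : ℂ) * Complex.exp (φ * Complex.I))

theorem sphereLift_mem (θ φ : ℝ) : sphereLift θ φ ∈ sphere3 := by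
  simp only [sphere3, sphereLift, Set.mem_ofPred_eq, norm_mul, Complex.norm_exp_ofReal_mul_I,
    mul_one, Complex.norm_real, Real.norm_eq_abs, sq_abs]
  exact Real.cos_sq_add_sin_sq _

theorem hopf_sphereLift (θ φ : ℝ) : hopf (sphereLift θ φ) = sphereParam θ φ := by
  have h1 : Real.sin θ = 2 * Real.sin (θ / 2) * Real.cos (θ / 2) := by
    rw [← Real.sin_two_mul]; congr 1; ring
  have h2 : Real.cos θ = Real.cos (θ / 2) ^ 2 - Real.sin (θ / 2) ^ 2 := by
    rw [← Real.cos_two_mul']; congr 1; ring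
  have h3 : star (Real.cos (θ / 2) : ℂ) *
      ((Real.sin (θ / 2) : ℂ) * Complex.exp (φ * Complex.I)) =
      ((Real.cos (θ / 2) * Real.sin (θ / 2) : ℝ) : ℂ) * Complex.exp (φ * Complex.I) := by
    rw [Complex.star_def, Complex.conj_ofReal]
    push_cast
    ring
  unfold hopf sphereParam sphereLift
  rw [h3, Complex.re_ofReal_mul, Complex.im_ofReal_mul, Complex.exp_ofReal_mul_I_re,
    Complex.exp_ofReal_mul_I_im, norm_mul, Complex.norm_exp_ofReal_mul_I, mul_one,
    Complex.norm_real, Complex.norm_real, Real.norm_eq_abs, Real.norm_eq_abs, sq_abs, sq_abs,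
    h1, h2]
  congr 1
  · ring
  · congr 1
    ring

/-- The modulus of the components of the equivariant vector, up to sign. -/
def amplitude (K j : ℕ) (θ : ℝ) : ℝ :=
  Real.sqrt (K.choose j) * (Real.cos (θ / 2) ^ (K - j) * Real.sin (θ / 2) ^ j)

theorem differentiable_amplitude (K j : ℕ) : Differentiable ℝ (amplitude K j) := by
  unfold amplitude
  fun_prop

/-- The squared moduli form a binomial distribution with parameter `sin²(θ/2)`, so its total mass
and mean are the standard Bernstein identities. -/
theorem amplitude_sq (K j : ℕ) (θ : ℝ) : amplitude K j θ ^ 2 =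
    (bernsteinPolynomial ℝ K j).eval (Real.sin (θ / 2) ^ 2) := by
  have h : 1 - Real.sin (θ / 2) ^ 2 = Real.cos (θ / 2) ^ 2 := by
    rw [Real.cos_sq']
  simp only [amplitude, bernsteinPolynomial, Polynomial.eval_mul, Polynomial.eval_natCast,
    Polynomial.eval_pow, Polynomial.eval_X, Polynomial.eval_sub, Polynomial.eval_one, h]
  rw [mul_pow, Real.sq_sqrt (by positivity)]
  ring

theorem sum_amplitude_sq (K : ℕ) (θ : ℝ) : ∑ j : Fin (K + 1), amplitude K j θ ^ 2 = 1 := by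
  rw [← Finset.sum_range fun j => amplitude K j θ ^ 2]
  simp only [amplitude_sq, ← Polynomial.eval_finsetSum, bernsteinPolynomial.sum,
    Polynomial.eval_one]

theorem sum_mul_amplitude_sq (K : ℕ) (θ : ℝ) :
    ∑ j : Fin (K + 1), ((j : ℕ) : ℝ) * amplitude K j θ ^ 2 = K * Real.sin (θ / 2) ^ 2 := by
  rw [← Finset.sum_range fun j => (j : ℝ) * amplitude K j θ ^ 2]
  have := congrArg (Polynomial.eval (Real.sin (θ / 2) ^ 2)) (bernsteinPolynomial.sum_smul ℝ K)
  simpa [Polynomial.eval_finsetSum, amplitude_sq] using this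

theorem hasDerivAt_sum_amplitude (K : ℕ) (w : ℕ → ℝ) (θ : ℝ) :
    HasDerivAt (fun t => ∑ j : Fin (K + 1), w j * amplitude K j t ^ 2)
      (2 * ∑ j : Fin (K + 1), w j * (amplitude K j θ * deriv (amplitude K j) θ)) θ := by
  rw [Finset.mul_sum]
  refine HasDerivAt.fun_sum fun j _ => ?_
  have h := ((differentiable_amplitude K j θ).hasDerivAt.pow 2).const_mul (w j)
  refine h.congr_deriv ?_
  push_cast
  ring

theorem sum_amplitude_mul_deriv (K : ℕ) (θ : ℝ) :
    ∑ j : Fin (K + 1), amplitude K j θ * deriv (amplitude K j) θ = 0 := by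
  have h := hasDerivAt_sum_amplitude K (fun _ => 1) θ
  simp only [one_mul, sum_amplitude_sq] at h
  have := h.unique (hasDerivAt_const θ (1 : ℝ))
  linarith

/-- Half the `θ`-derivative of the binomial mean `K sin²(θ/2)`. -/
theorem sum_mul_amplitude_mul_deriv (K : ℕ) (θ : ℝ) :
    ∑ j : Fin (K + 1), ((j : ℕ) : ℝ) * (amplitude K j θ * deriv (amplitude K j) θ) =
      K * Real.sin θ / 4 := by
  have h := hasDerivAt_sum_amplitude K (fun j => (j : ℝ)) θ
  simp only [sum_mul_amplitude_sq] at h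
  have h1 : HasDerivAt (fun t : ℝ => (K : ℝ) * Real.sin (t / 2) ^ 2)
      (K * (2 * Real.sin (θ / 2) * (Real.cos (θ / 2) * (1 / 2)))) θ := by
    have := ((((hasDerivAt_id θ).div_const 2).sin).pow 2).const_mul (K : ℝ)
    simpa using this
  have h2 : Real.sin θ = 2 * Real.sin (θ / 2) * Real.cos (θ / 2) := by
    rw [← Real.sin_two_mul]; congr 1; ring
  have := h.unique h1
  rw [h2]
  linarith

/-- The sign of an integer, with `0` counted as positive. -/
def orientation (k : ℤ) : ℝ := if 0 ≤ k then 1 else -1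

theorem orientation_mul_natAbs (k : ℤ) : (orientation k : ℂ) * (k.natAbs : ℂ) = k := by
  unfold orientation
  split_ifs with h
  · have : ((k.natAbs : ℤ) : ℂ) = (k : ℂ) := by rw [Int.natAbs_of_nonneg h]
    simpa using this
  · have : ((k.natAbs : ℤ) : ℂ) = ((-k : ℤ) : ℂ) := by rw [Int.ofNat_natAbs_of_nonpos (by omega)]
    rw [Int.cast_natCast, Int.cast_neg] at this
    rw [this]
    push_cast
    ring

theorem equivVec_sphereLift (k : ℤ) (θ φ : ℝ) (j : Fin (k.natAbs + 1)) :
    equivVec k (sphereLift θ φ) j = (amplitude k.natAbs j θ : ℂ) *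
      Complex.exp ((j : ℕ) * (orientation k * φ * Complex.I)) := by
  unfold equivVec sphereLift amplitude orientation
  split_ifs with h
  · simp only [mul_pow, ← Complex.exp_nat_mul]
    push_cast
    ring_nf
  · have : star (Complex.exp (φ * Complex.I)) = Complex.exp (-(φ * Complex.I)) := by
      rw [Complex.star_def, ← Complex.exp_conj]
      simp
    simp only [star_mul', mul_pow, this, ← Complex.exp_nat_mul, Complex.star_def,
      Complex.conj_ofReal]
    push_cast
    ring_nf

/-- Independence of the lift allows `sphereLift`, for which moduli depend on `θ` alone and phases on
`φ` alone. -/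
theorem lineBundleProjector_sphereParam (k : ℤ) (θ φ : ℝ) (i j : Fin (k.natAbs + 1)) :
    lineBundleProjector k (sphereParam θ φ) i j =
      ((amplitude k.natAbs i θ * amplitude k.natAbs j θ : ℝ) : ℂ) *
        Complex.exp (φ * (orientation k * (((i : ℕ) : ℂ) - (j : ℕ)) * Complex.I)) := by
  rw [← hopf_sphereLift, lineBundleProjector_hopf k (sphereLift_mem θ φ), hopfProjector,
    Matrix.vecMulVec_apply, Pi.star_apply, equivVec_sphereLift, equivVec_sphereLift, star_mul',
    Complex.star_def, Complex.conj_ofReal, ← Complex.exp_conj]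
  have : (starRingEnd ℂ) (((j : ℕ) : ℂ) * (orientation k * φ * Complex.I)) =
      -(((j : ℕ) : ℂ) * (orientation k * φ * Complex.I)) := by
    simp
  rw [this, show (φ : ℂ) * (orientation k * (((i : ℕ) : ℂ) - (j : ℕ)) * Complex.I) =
    ((i : ℕ) : ℂ) * (orientation k * φ * Complex.I) +
      -(((j : ℕ) : ℂ) * (orientation k * φ * Complex.I)) by ring, Complex.exp_add]
  push_cast
  ring

theorem deriv_lineBundleProjector_left (k : ℤ) (θ φ : ℝ) (i j : Fin (k.natAbs + 1)) :
    deriv (fun t => lineBundleProjector k (sphereParam t φ) i j) θ =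
      ((deriv (amplitude k.natAbs i) θ * amplitude k.natAbs j θ +
        amplitude k.natAbs i θ * deriv (amplitude k.natAbs j) θ : ℝ) : ℂ) *
        Complex.exp (φ * (orientation k * (((i : ℕ) : ℂ) - (j : ℕ)) * Complex.I)) := by
  simp only [lineBundleProjector_sphereParam]
  have h := ((differentiable_amplitude k.natAbs i θ).hasDerivAt.mul
    (differentiable_amplitude k.natAbs j θ).hasDerivAt).ofReal_comp
  exact (h.mul_const _).deriv

theorem deriv_lineBundleProjector_right (k : ℤ) (θ φ : ℝ) (i j : Fin (k.natAbs + 1)) :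
    deriv (fun t => lineBundleProjector k (sphereParam θ t) i j) φ =
      ((amplitude k.natAbs i θ * amplitude k.natAbs j θ : ℝ) : ℂ) *
        (Complex.exp (φ * (orientation k * (((i : ℕ) : ℂ) - (j : ℕ)) * Complex.I)) *
          (orientation k * (((i : ℕ) : ℂ) - (j : ℕ)) * Complex.I)) := by
  simp only [lineBundleProjector_sphereParam]
  have h := (((hasDerivAt_id φ).ofReal_comp).mul_const
    ((orientation k : ℂ) * (((i : ℕ) : ℂ) - (j : ℕ)) * Complex.I)).cexp
  simpa using (h.const_mul ((amplitude k.natAbs i θ * amplitude k.natAbs j θ : ℝ) : ℂ)).deriv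

/-- The curvature sum of a normalized vector with moduli `r` and phases proportional to `w`. -/
theorem curvature_sum {ι : Type} [Fintype ι] (r r' w : ι → ℂ) (hS : ∑ i, r i ^ 2 = 1)
    (hR : ∑ i, r i * r' i = 0) :
    ∑ i, ∑ j, ∑ k, r i * r j * ((r' j * r k + r j * r' k) * (r k * r i * (w k - w i)) -
      r j * r k * (w j - w k) * (r' k * r i + r k * r' i)) =
      2 * ∑ i, w i * (r i * r' i) := by
  -- Every summand is split into one factor per index. All terms but the third contain an unweighted
  -- `r * r'`, whose sum is zero.
  have e : ∀ i j k, r i * r j * ((r' j * r k + r j * r' k) * (r k * r i * (w k - w i)) -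
      r j * r k * (w j - w k) * (r' k * r i + r k * r' i)) =
      r i ^ 2 * ((r j * r' j) * (w k * r k ^ 2)) - (w i * r i ^ 2) * ((r j * r' j) * r k ^ 2) +
      2 * (r i ^ 2 * (r j ^ 2 * (w k * (r k * r' k)))) -
      (w i * r i ^ 2) * (r j ^ 2 * (r k * r' k)) -
      r i ^ 2 * ((w j * r j ^ 2) * (r k * r' k)) -
      (r i * r' i) * ((w j * r j ^ 2) * r k ^ 2) +
      (r i * r' i) * (r j ^ 2 * (w k * r k ^ 2)) := fun i j k => by ring
  simp only [e, Finset.sum_add_distrib, Finset.sum_sub_distrib, ← Finset.mul_sum,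
    ← Finset.sum_mul, hS, hR]
  ring

/-- The phases around the closed cycle `i → j → m → i` multiply to one, leaving `curvature_sum` for
the moduli, with weights `w j = j`. -/
theorem curvature_lineBundleProjector (k : ℤ) (θ φ : ℝ) :
    ∑ i, ∑ j, ∑ m, lineBundleProjector k (sphereParam θ φ) i j *
      (deriv (fun t => lineBundleProjector k (sphereParam t φ) j m) θ *
        deriv (fun t => lineBundleProjector k (sphereParam θ t) m i) φ -
      deriv (fun t => lineBundleProjector k (sphereParam θ t) j m) φ *
        deriv (fun t => lineBundleProjector k (sphereParam t φ) m i) θ) =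
      Complex.I * k / 2 * (Real.sin θ : ℂ) := by
  have hS : ∑ i : Fin (k.natAbs + 1), (amplitude k.natAbs i θ : ℂ) ^ 2 = 1 := by
    exact_mod_cast congrArg (fun x : ℝ => (x : ℂ)) (sum_amplitude_sq k.natAbs θ)
  have hR : ∑ i : Fin (k.natAbs + 1),
      (amplitude k.natAbs i θ : ℂ) * (deriv (amplitude k.natAbs i) θ : ℝ) = 0 := by
    exact_mod_cast congrArg (fun x : ℝ => (x : ℂ)) (sum_amplitude_mul_deriv k.natAbs θ)
  have hD : ∑ i : Fin (k.natAbs + 1), ((i : ℕ) : ℂ) *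
      ((amplitude k.natAbs i θ : ℂ) * (deriv (amplitude k.natAbs i) θ : ℝ)) =
        k.natAbs * Real.sin θ / 4 := by
    have := congrArg (fun x : ℝ => (x : ℂ)) (sum_mul_amplitude_mul_deriv k.natAbs θ)
    push_cast at this ⊢
    exact this
  have key := curvature_sum _ _ (fun i : Fin (k.natAbs + 1) => ((i : ℕ) : ℂ)) hS hR
  rw [hD] at key
  calc _ = (orientation k * Complex.I) * (2 * (k.natAbs * Real.sin θ / 4)) := by
        rw [← key]
        simp only [Finset.mul_sum]
        refine Finset.sum_congr rfl fun i _ => Finset.sum_congr rfl fun j _ =>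
          Finset.sum_congr rfl fun m _ => ?_
        rw [deriv_lineBundleProjector_left, deriv_lineBundleProjector_left,
          deriv_lineBundleProjector_right, deriv_lineBundleProjector_right,
          lineBundleProjector_sphereParam]
        have hphase : Complex.exp (φ * (orientation k * (((i : ℕ) : ℂ) - (j : ℕ)) * Complex.I)) *
            (Complex.exp (φ * (orientation k * (((j : ℕ) : ℂ) - (m : ℕ)) * Complex.I)) *
            Complex.exp (φ * (orientation k * (((m : ℕ) : ℂ) - (i : ℕ)) * Complex.I))) = 1 := by
          rw [← Complex.exp_add, ← Complex.exp_add, ← Complex.exp_zero]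
          congr 1
          ring
        generalize Complex.exp (φ * (orientation k * (((i : ℕ) : ℂ) - (j : ℕ)) * Complex.I)) = x
          at *
        generalize Complex.exp (φ * (orientation k * (((j : ℕ) : ℂ) - (m : ℕ)) * Complex.I)) = y
          at *
        generalize Complex.exp (φ * (orientation k * (((m : ℕ) : ℂ) - (i : ℕ)) * Complex.I)) = z
          at *
        push_cast
        generalize (amplitude k.natAbs i θ : ℂ) = ri
        generalize (amplitude k.natAbs j θ : ℂ) = rj
        generalize (amplitude k.natAbs m θ : ℂ) = rm
        generalize ((deriv (amplitude k.natAbs i) θ : ℝ) : ℂ) = si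
        generalize ((deriv (amplitude k.natAbs j) θ : ℝ) : ℂ) = sj
        generalize ((deriv (amplitude k.natAbs m) θ : ℝ) : ℂ) = sm
        linear_combination (orientation k * Complex.I) * (ri * rj *
          ((sj * rm + rj * sm) * (rm * ri * (((m : ℕ) : ℂ) - (i : ℕ))) -
            rj * rm * (((j : ℕ) : ℂ) - (m : ℕ)) * (sm * ri + rm * si))) * hphase
    _ = _ := by
      rw [← orientation_mul_natAbs k]
      ring

theorem sphereChern_lineBundleProjector (k : ℤ) :
    sphereChern (lineBundleProjector k) = -(k : ℂ) := by
  have hpi : (Real.pi : ℂ) ≠ 0 := by exact_mod_cast Real.pi_ne_zero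
  unfold sphereChern
  simp only [curvature_lineBundleProjector, intervalIntegral.integral_const, sub_zero]
  rw [intervalIntegral.integral_smul, intervalIntegral.integral_const_mul,
    intervalIntegral.integral_ofReal, integral_sin, Real.cos_zero, Real.cos_pi, Complex.real_smul]
  push_cast
  field_simp
  rw [Complex.I_sq]
  ring

end FuzzySphere

end

open FuzzySphere in
theorem mainTheorem2 :
    -- the fuzzy integral is well defined on the multiples of the volume form
    (∀ n : ℕ, 0 < n → ∀ φ : Alg n,
      fuzzyIntegral n (φ • volForm n) = φ.trace / ((n : ℂ) + 1)) ∧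
    -- projection onto `[N + ν]`, where `N = n / 2` and `ν = l / 2`
    (∀ n l : ℕ, 0 < n →
      (∃! W, IsSpinSubrep n l (n + l) W) ∧
      fuzzyChernForm n l (n + l) =
        (Complex.I * charge (n / 2) (fPlus (n / 2) (l / 2)) / 4) • epsYdYdY n ∧
      fuzzyChern n l (n + l) = -charge (n / 2) (fPlus (n / 2) (l / 2)) ∧
      (0 < l → ∀ z : ℤ, fuzzyChern n l (n + l) ≠ z)) ∧
    -- projection onto `[N - ν]`, where `N > ν`
    (∀ n l : ℕ, l < n →
      (∃! W, IsSpinSubrep n l (n - l) W) ∧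
      fuzzyChernForm n l (n - l) =
        (Complex.I * charge (n / 2) (fMinus (n / 2) (l / 2)) / 4) • epsYdYdY n ∧
      fuzzyChern n l (n - l) = -charge (n / 2) (fMinus (n / 2) (l / 2)) ∧
      (0 < l → ∀ z : ℤ, fuzzyChern n l (n - l) ≠ z)) ∧
    -- the commutative limits `∓ 2 ν = ∓ l`
    (∀ l : ℕ,
      Filter.Tendsto (fun n : ℕ => fuzzyChern n l (n + l)) Filter.atTop (nhds (-(l : ℂ))) ∧
      Filter.Tendsto (fun n : ℕ => fuzzyChern n l (n - l)) Filter.atTop (nhds (l : ℂ))) ∧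
    -- these are the Chern numbers of the line bundles `L^k` over the two-sphere, `k = ± 2 ν`
    (∀ k : ℤ, sphereChern (lineBundleProjector k) = -(k : ℂ)) := by
  refine ⟨fun n hn φ => fuzzyIntegral_smul_volForm hn φ, fun n l hn => ?_, fun n l hln => ?_,
    fun l => ⟨tendsto_fuzzyChern_plus l, tendsto_fuzzyChern_minus l⟩,
    sphereChern_lineBundleProjector⟩
  · obtain ⟨hW, hF, hc⟩ := fuzzyChern_plus n l hn
    exact ⟨hW, hF, hc, fun hl z => fuzzyChern_plus_ne_intCast hn hl z⟩
  · obtain ⟨hW, hF, hc⟩ := fuzzyChern_minus n l hln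
    exact ⟨hW, hF, hc, fun hl z => fuzzyChern_minus_ne_intCast hln hl z⟩
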